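/- Let $k$ be an algebraically closed field of characteristic $\neq 2$, $R=k[x,y,z]$, and let $J\subset R$ be the defining ideal of four points of $\mathbb{P}^2_k$ in general linear position (no three on a line). Let $I=(J,I_2(\Theta))$ be the Jacobian ideal of $J$, where $\Theta$ is the Jacobian matrix of a finite set of generators of $J$ and $I_t(M)$ denotes the ideal generated by the $t$-minors of a matrix $M$. There is a $5\times 5$ skew-symmetric matrix $\phi$ of linear forms of $R$ whose five (signed) $4\times 4$ Pfaffians $f_1,\dots,f_5$ generate $I$. For every such $\phi$, let $\mathbf T=(T_1,\dots,T_5)$ be new variables and let $\psi$ be the Jacobian dual matrix of $\phi$, that is, the $5\times 3$ Jacobian matrix with respect to $x,y,z$ of the entries of $\mathbf T\cdot\phi$. Then $T_i\mapsto f_it$ induces an isomorphism of $R$-algebras $$R[\mathbf T]/\bigl(I_1(\mathbf T\cdot\phi),\,I_3(\psi)\bigr)\;\simeq\;\mathcal R_R(I)=\bigoplus_{s\ge 0}I^st^s .$$ Thus $I$ is of fiber type: the kernel of $R[\mathbf T]\to\mathcal R_R(I)$, $T_i\mapsto f_it$, is generated by its elements that are linear in $\mathbf T$ and its elements in $k[\mathbf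 T]$. Moreover $\mathcal R_R(I)$ has depth $1$ (with respect to its maximal homogeneous ideal $(x,y,z,It)$). -/

import Mathlib

open MvPolynomial
open scoped LinearAlgebra.Projectivization

noncomputable section

namespace JacobianRees

variable {k : Type*} [Field k]

/-- Points of `ℙⁿ` (at least `n + 1` of them) are in general linear position if no `n + 1` of them
lie in a hyperplane, i.e. if any `n + 1` of them are independent. -/
def InGeneralLinearPosition {n s : ℕ} (p : Fin s → ℙ k (Fin (n + 1) → k)) : Prop :=
  ∀ σ : Fin (n + 1) ↪ Fin s, Projectivization.Independent (fun i => p (σ i))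

/-- The homogeneous ideal of a point of projective space, generated by the forms that vanish at
the point. -/
def pointIdeal {n : ℕ} (p : ℙ k (Fin (n + 1) → k)) : Ideal (MvPolynomial (Fin (n + 1)) k) :=
  Ideal.span {f | ∃ d : ℕ, f.IsHomogeneous d ∧ eval p.rep f = 0}

/-- The defining ideal of a finite set of points: the intersection of the ideals of the points. -/
def pointsIdeal {n s : ℕ} (p : Fin s → ℙ k (Fin (n + 1) → k)) :
    Ideal (MvPolynomial (Fin (n + 1)) k) :=
  ⨅ i, pointIdeal (p i)

/-- The ideal `I_t(M)` generated by the `t × t` minors of `M`. (Repeated rows or columns only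
contribute the minor `0`.) -/
def minorsIdeal {A : Type*} [CommRing A] {a b : ℕ} (t : ℕ) (M : Matrix (Fin a) (Fin b) A) :
    Ideal A :=
  Ideal.span {d | ∃ (r : Fin t → Fin a) (c : Fin t → Fin b), d = (M.submatrix r c).det}

/-- The Jacobian matrix of a finite sequence of polynomials. -/
def jacobianMatrix {n m : ℕ} (g : Fin m → MvPolynomial (Fin n) k) :
    Matrix (Fin m) (Fin n) (MvPolynomial (Fin n) k) :=
  Matrix.of fun i j => pderiv j (g i)

/-- The Jacobian ideal `(J, I_r(Θ))` of `J = (g)`, with `Θ` the Jacobian matrix of `g`;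
here `r` is to be the height of `J`. -/
def jacobianIdeal {n m : ℕ} (r : ℕ) (g : Fin m → MvPolynomial (Fin n) k) :
    Ideal (MvPolynomial (Fin n) k) :=
  Ideal.span (Set.range g) ⊔ minorsIdeal r (jacobianMatrix g)

/-- The Pfaffian of a `4 × 4` skew-symmetric matrix. -/
def pfaffian4 {A : Type*} [CommRing A] (M : Matrix (Fin 4) (Fin 4) A) : A :=
  M 0 1 * M 2 3 - M 0 2 * M 1 3 + M 0 3 * M 1 2

/-- The five signed (submaximal) Pfaffians of a `5 × 5` skew-symmetric matrix: the `i`-th one is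
`(-1)ⁱ` times the Pfaffian of the matrix with row and column `i` deleted. -/
def pfaffians {A : Type*} [CommRing A] (φ : Matrix (Fin 5) (Fin 5) A) (i : Fin 5) : A :=
  (-1) ^ (i : ℕ) * pfaffian4 (φ.submatrix i.succAbove i.succAbove)

/-- `φ` is a `5 × 5` skew-symmetric matrix of linear forms whose Pfaffians generate `I`. -/
structure IsPfaffianMatrix {n : ℕ} (φ : Matrix (Fin 5) (Fin 5) (MvPolynomial (Fin n) k))
    (I : Ideal (MvPolynomial (Fin n) k)) : Prop where
  skew : φ.transpose = -φ
  linear : ∀ i j, (φ i j).IsHomogeneous 1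
  span_eq : Ideal.span (Set.range (pfaffians φ)) = I

/-- The entries of the row vector `T · φ`, in `R[T]`. -/
def TMul {A : Type*} [CommRing A] {a b : ℕ} (φ : Matrix (Fin a) (Fin b) A) (j : Fin b) :
    MvPolynomial (Fin a) A :=
  ∑ i, X i * C (φ i j)

/-- The partial derivative `∂/∂x_l` on `R[T] = k[x][T]`, i.e. `∂/∂x_l` of the coefficients. -/
def xDeriv {n a : ℕ} (l : Fin n) (P : MvPolynomial (Fin a) (MvPolynomial (Fin n) k)) :
    MvPolynomial (Fin a) (MvPolynomial (Fin n) k) :=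
  ∑ e ∈ P.support, monomial e (pderiv l (P.coeff e))

/-- The Jacobian dual matrix of `φ`: the Jacobian matrix of the entries of `T · φ` with respect to
the variables `x`. -/
def jacobianDual {n a b : ℕ} (φ : Matrix (Fin a) (Fin b) (MvPolynomial (Fin n) k)) :
    Matrix (Fin b) (Fin n) (MvPolynomial (Fin a) (MvPolynomial (Fin n) k)) :=
  Matrix.of fun j l => xDeriv l (TMul φ j)

/-- The ideal `(I_1(T · φ), I_3(ψ))` of `R[T]`, with `ψ` the Jacobian dual matrix of `φ`. -/
def dualIdeal {n a b : ℕ} (φ : Matrix (Fin a) (Fin b) (MvPolynomial (Fin n) k)) :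
    Ideal (MvPolynomial (Fin a) (MvPolynomial (Fin n) k)) :=
  Ideal.span (Set.range (TMul φ)) ⊔ minorsIdeal 3 (jacobianDual φ)

/-- The presentation ideal of the Rees algebra of `(f)` with respect to `f`: the kernel of
`R[T] → R[t]`, `T_i ↦ f_i t`. -/
def reesIdeal {A : Type*} [CommRing A] {m : ℕ} (f : Fin m → A) : Ideal (MvPolynomial (Fin m) A) :=
  RingHom.ker (aeval (fun i => Polynomial.monomial 1 (f i)) :
    MvPolynomial (Fin m) A →ₐ[A] Polynomial A)

/-- The presentation ideal of the Rees algebra is generated by its elements that are linear in `T`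
(the relations of the symmetric algebra) and by its elements in `k[T]` (the relations of the
special fiber; `f` consists of forms of one degree). -/
def HasFiberTypeRelations {n m : ℕ} (f : Fin m → MvPolynomial (Fin n) k) : Prop :=
  reesIdeal f =
    Ideal.span {P | P ∈ reesIdeal f ∧ P.IsHomogeneous 1} ⊔
    Ideal.span {P | P ∈ reesIdeal f ∧ ∃ Q : MvPolynomial (Fin m) k, P = map C Q}

/-- An ideal generated by forms of one degree is of fiber type if its Rees algebra, presented by
such generators, has only fiber type relations. -/
def IsFiberType {n : ℕ} (I : Ideal (MvPolynomial (Fin n) k)) : Prop :=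
  ∃ (m d : ℕ) (f : Fin m → MvPolynomial (Fin n) k),
    (∀ i, (f i).IsHomogeneous d) ∧ Ideal.span (Set.range f) = I ∧ HasFiberTypeRelations f

/-- The maximal homogeneous ideal `(x, It)` of the Rees algebra of `I ⊆ k[x]`: the elements whose
component of degree `0` in `t` has no constant term. -/
def reesMaximalIdeal {n : ℕ} (I : Ideal (MvPolynomial (Fin n) k)) : Ideal (reesAlgebra I) :=
  RingHom.ker (((constantCoeff : MvPolynomial (Fin n) k →+* k).comp
    (Polynomial.constantCoeff : Polynomial (MvPolynomial (Fin n) k) →+* _)).comp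
      (reesAlgebra I).val.toRingHom)

/-- The depth (grade) of a ring `A` along an ideal `𝔞`: the supremum of the lengths of the
`A`-regular sequences in `𝔞`. -/
def depthAlong {A : Type*} [CommRing A] (𝔞 : Ideal A) : ℕ∞ :=
  ⨆ (rs : List A) (_ : RingTheory.Sequence.IsRegular A rs) (_ : ∀ r ∈ rs, r ∈ 𝔞),
    (rs.length : ℕ∞)

end JacobianRees

end

open JacobianRees

/-! In coordinates where the four points are (±1, ±1, 1), J = (x² - z², y² - z²) and I is generated
by xy, xz, yz, x² - z², y² - z², which together with z² span all quadrics. So the Rees algebra of I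
differs from that of (x, y, z)² by the single element W = z²t: each generator times W, and also W²,
is a polynomial in the generators (`mulW`, `sqW`). Both the depth and the equations come from this.

Depth: the Rees algebra is a domain, so its depth is at least one. If a, b lie in the maximal
homogeneous ideal, then aW lies in the Rees algebra and b · aW = a · bW, while aW is not a multiple
of a there. So no regular sequence starts with a, b.

Equations: the Rees algebra of (x, y, z)² is toric, and its relations follow from quadratic
binomials (`aeval_eq_zero_of_veroneseMap_eq_zero`). Let A be the polynomial ring in eight variables
v modulo the five linear syzygies and the consistency relations v_i (v_j W) = v_j (v_i W) and v_i W²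
= (v_i W) W, with W eliminated by means of `mulW` and `sqW`. Since multiplication by W preserves the
syzygies (`linCoeff_mulW`), A + kW is an algebra (`exists_extensionData`). The binomials hold in it,
so every relation of the Rees algebra of I vanishes in A + kW, hence in A. The consistency relations
are in turn consequences of the linear syzygies and of the 3 × 3 minors of their coefficient matrix
(`mul_mulW_comm`, `mul_sqW`).

For an arbitrary φ, the columns are five independent linear syzygies of the quadrics, and for 2 ≠ 0
such syzygies form a space of dimension five. Hence ψ agrees with that coefficient matrix up to
invertible matrices over k (`exists_linCoeff_eq`). Conversely, modulo T · φ the matrix ψ kills (x,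
y, z), which forces its maximal minors to vanish in a domain. -/

noncomputable section

namespace JacobianRees

/-! ### Products of second Veronese coordinates indexed by lists -/

section Toric

variable {ι B : Type*} [CommRing B]

/-- `S i₁ i₂ * S i₃ i₄ * ⋯` for the first `s` pairs of the list, times the product of the `ξ i`
over the rest of the list. -/
def listProd (ξ : ι → B) (S : ι → ι → B) : ℕ → List ι → B
  | 0, l => (l.map ξ).prod
  | s + 1, i :: j :: l => S i j * listProd ξ S s l
  | _ + 1, _ => 0

variable {ξ : ι → B} {S : ι → ι → B}

/-- The two neighbours may form one pair (symmetry of `S`), belong to two consecutive pairs (`h2`),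
straddle the last pair and the single factors (`h1`), or both be single factors (commutativity). -/
lemma listProd_swap (hS : ∀ i j, S i j = S j i) (h1 : ∀ i j k, ξ i * S j k = ξ j * S i k)
    (h2 : ∀ i j k l, S i j * S k l = S i k * S j l) (i j : ι) (r : List ι) :
    ∀ (s : ℕ) (p : List ι),
      listProd ξ S s (p ++ i :: j :: r) = listProd ξ S s (p ++ j :: i :: r)
  | 0, p => by
      simp only [listProd, List.map_append, List.map_cons, List.prod_append, List.prod_cons]
      ring
  | s + 1, [] => by simp [listProd, hS i j]
  | 1, [a] => by
      simp only [listProd, List.cons_append, List.nil_append, List.map_cons, List.prod_cons]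
      linear_combination (r.map ξ).prod * (h1 j i a - hS i a * ξ j + hS j a * ξ i)
  | s + 2, [a] => by
      cases r with
      | nil => simp [listProd]
      | cons b r =>
        simp only [listProd, List.cons_append, List.nil_append]
        linear_combination (listProd ξ S s r) * h2 a i j b
  | s + 1, a :: b :: p => by
      simp only [listProd, List.cons_append]
      rw [listProd_swap hS h1 h2 i j r s p]

lemma listProd_perm (hS : ∀ i j, S i j = S j i) (h1 : ∀ i j k, ξ i * S j k = ξ j * S i k)
    (h2 : ∀ i j k l, S i j * S k l = S i k * S j l) (s : ℕ) {l l' : List ι} (h : l.Perm l') :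
    listProd ξ S s l = listProd ξ S s l' := by
  -- The arbitrary prefix absorbs the common head in the `cons` case of the induction.
  suffices ∀ p : List ι, listProd ξ S s (p ++ l) = listProd ξ S s (p ++ l') by simpa using this []
  induction h with
  | nil => simp
  | cons x _ ih => intro p; simpa using ih (p ++ [x])
  | swap x y l => intro p; exact listProd_swap hS h1 h2 _ _ _ _ _
  | trans _ _ ih1 ih2 => intro p; rw [ih1, ih2]

/-- The length bound ensures that the new index becomes a single factor and does not complete a
pair. -/
lemma listProd_append_singleton (i : ι) : ∀ (s : ℕ) (l : List ι), 2 * s ≤ l.length →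
    listProd ξ S s (l ++ [i]) = ξ i * listProd ξ S s l
  | 0, l, _ => by simp [listProd, mul_comm]
  | s + 1, [], h => by simp at h
  | s + 1, [a], h => by simp at h; omega
  | s + 1, a :: b :: l, h => by
      simp only [listProd, List.cons_append]
      rw [listProd_append_singleton i s l (by simp at h; omega)]
      ring

variable {k : Type*} [Field k] [Algebra k B]

/-- The linear map sending `x^α t^s` to the list product of the indices of `x^α`. -/
def toricSection (k : Type*) [Field k] [Algebra k B] (ξ : ι → B) (S : ι → ι → B) :
    Polynomial (MvPolynomial ι k) →ₗ[k] B :=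
  Polynomial.lsum fun s => (basisMonomials ι k).constr k
    fun α => listProd ξ S s (Finsupp.toMultiset α).toList

lemma toricSection_monomial (s : ℕ) (α : ι →₀ ℕ) (a : k) :
    toricSection k ξ S (Polynomial.monomial s (monomial α a)) =
      a • listProd ξ S s (Finsupp.toMultiset α).toList := by
  have h : (monomial α a : MvPolynomial ι k) = a • basisMonomials ι k α := by
    simp [smul_monomial]
  rw [toricSection, Polynomial.lsum_apply, Polynomial.sum_monomial_index _ _ (by simp), h,
    map_smul, Module.Basis.constr_basis]

/-- The map `x_i ↦ x_i`, `S_ij ↦ x_i x_j t` onto the Rees algebra of the square of the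
homogeneous maximal ideal. -/
def veroneseMap (ι k : Type*) [Field k] :
    MvPolynomial (ι ⊕ ι × ι) k →ₐ[k] Polynomial (MvPolynomial ι k) :=
  aeval (Sum.elim (fun i => Polynomial.C (X i)) fun ij => Polynomial.monomial 1 (X ij.1 * X ij.2))

/-- The value in `B` of a monomial in the Veronese coordinates depends only on its image x^α t^s,
because the binomial relations allow the indices in α to be arranged in any order. Hence evaluation
in `B` factors through `veroneseMap`. -/
lemma toricSection_veroneseMap (hS : ∀ i j, S i j = S j i)
    (h1 : ∀ i j k, ξ i * S j k = ξ j * S i k)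
    (h2 : ∀ i j k l, S i j * S k l = S i k * S j l) (g : MvPolynomial (ι ⊕ ι × ι) k) :
    toricSection k ξ S (veroneseMap ι k g) = aeval (Sum.elim ξ fun ij => S ij.1 ij.2) g := by
  induction g using MvPolynomial.induction_on' with
  | add p q hp hq => simp only [map_add, hp, hq]
  | monomial u a =>
    suffices ∃ (α : ι →₀ ℕ) (s : ℕ) (b : k), 2 * s ≤ (Finsupp.toMultiset α).toList.length ∧
        veroneseMap ι k (monomial u a) = Polynomial.monomial s (monomial α b) ∧
        aeval (Sum.elim ξ fun ij => S ij.1 ij.2) (monomial u a) =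
          b • listProd ξ S s (Finsupp.toMultiset α).toList by
      obtain ⟨α, s, b, -, h, h'⟩ := this
      rw [h, h', toricSection_monomial]
    refine induction_on_monomial (motive := fun g => ∃ (α : ι →₀ ℕ) (s : ℕ) (b : k),
      2 * s ≤ (Finsupp.toMultiset α).toList.length ∧
        veroneseMap ι k g = Polynomial.monomial s (monomial α b) ∧
        aeval (Sum.elim ξ fun ij => S ij.1 ij.2) g =
          b • listProd ξ S s (Finsupp.toMultiset α).toList) ?_ ?_ u a
    · intro b
      refine ⟨0, 0, b, by simp, ?_, ?_⟩
      · simp only [veroneseMap, algHom_C]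
        rfl
      · simp [listProd, Algebra.algebraMap_eq_smul_one]
    · rintro p n ⟨α, s, b, hs, hp, hp'⟩
      rcases n with i | ⟨i, j⟩
      -- A new factor ξ_i goes to the end of the list; a new factor S_ij goes to its front as an
      -- additional pair.
      · have hperm : (Finsupp.toMultiset (α + Finsupp.single i 1)).toList.Perm
            ((Finsupp.toMultiset α).toList ++ [i]) := by
          rw [← Multiset.coe_eq_coe, ← Multiset.coe_add]
          simp
        refine ⟨α + Finsupp.single i 1, s, b, ?_, ?_, ?_⟩
        · rw [hperm.length_eq, List.length_append]; omega
        · rw [map_mul, hp, veroneseMap, aeval_X, Sum.elim_inl, Polynomial.monomial_mul_C, X,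
            monomial_mul, mul_one]
        · rw [map_mul, hp', aeval_X, Sum.elim_inl, listProd_perm hS h1 h2 s hperm,
            listProd_append_singleton i s _ hs, smul_mul_assoc, mul_comm]
      · have hperm : (Finsupp.toMultiset
            (α + (Finsupp.single i 1 + Finsupp.single j 1))).toList.Perm
            (i :: j :: (Finsupp.toMultiset α).toList) := by
          rw [← Multiset.coe_eq_coe, ← Multiset.cons_coe, ← Multiset.cons_coe]
          simp only [Multiset.coe_toList, map_add, Finsupp.toMultiset_single, one_smul,
            ← Multiset.singleton_add]
          abel
        refine ⟨α + (Finsupp.single i 1 + Finsupp.single j 1), s + 1, b, ?_, ?_, ?_⟩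
        · rw [hperm.length_eq, List.length_cons, List.length_cons]; omega
        · rw [map_mul, hp, veroneseMap, aeval_X, Sum.elim_inr, Polynomial.monomial_mul_monomial, X,
            X, monomial_mul, monomial_mul, mul_one, mul_one]
        · rw [map_mul, hp', aeval_X, Sum.elim_inr, listProd_perm hS h1 h2 _ hperm, listProd,
            smul_mul_assoc, mul_comm]

/-- The quadratic relations of the Veronese coordinates generate all their relations. -/
theorem aeval_eq_zero_of_veroneseMap_eq_zero (hS : ∀ i j, S i j = S j i)
    (h1 : ∀ i j k, ξ i * S j k = ξ j * S i k)
    (h2 : ∀ i j k l, S i j * S k l = S i k * S j l) {g : MvPolynomial (ι ⊕ ι × ι) k}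
    (hg : veroneseMap ι k g = 0) : aeval (Sum.elim ξ fun ij => S ij.1 ij.2) g = 0 := by
  rw [← toricSection_veroneseMap hS h1 h2, hg, map_zero]

end Toric

/-! ### Adjoining an element that the augmentation ideal multiplies into the ring -/

section Extension

variable {k A : Type*} [Field k] [CommRing A] [Algebra k A]

/-- The data of a multiplication by a new element `W` on an augmented algebra `A`:
`a W = τ a + ε a W` and `W ^ 2 = q`. -/
structure ExtensionData (k A : Type*) [Field k] [CommRing A] [Algebra k A] where
  ε : A →ₐ[k] k
  τ : A →ₗ[k] A
  q : A
  τ_mul : ∀ a b, τ (a * b) = a * τ b + algebraMap k A (ε b) * τ a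
  τ_τ : ∀ a, τ (τ a) = q * (a - algebraMap k A (ε a))
  ε_τ : ∀ a, ε (τ a) = 0

/-- The algebra `A + k W`. -/
@[ext]
structure Extension (D : ExtensionData k A) where
  fst : A
  snd : k

namespace Extension

variable {D : ExtensionData k A}

instance : Zero (Extension D) := ⟨⟨0, 0⟩⟩
instance : One (Extension D) := ⟨⟨1, 0⟩⟩
instance : Add (Extension D) := ⟨fun a b => ⟨a.fst + b.fst, a.snd + b.snd⟩⟩
instance : Neg (Extension D) := ⟨fun a => ⟨-a.fst, -a.snd⟩⟩
instance : Mul (Extension D) := ⟨fun a b =>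
  ⟨a.fst * b.fst + algebraMap k A (a.snd * b.snd) * D.q + algebraMap k A a.snd * D.τ b.fst
    + algebraMap k A b.snd * D.τ a.fst, a.snd * D.ε b.fst + b.snd * D.ε a.fst⟩⟩

@[simp] lemma zero_fst : (0 : Extension D).fst = 0 := rfl
@[simp] lemma zero_snd : (0 : Extension D).snd = 0 := rfl
@[simp] lemma one_fst : (1 : Extension D).fst = 1 := rfl
@[simp] lemma one_snd : (1 : Extension D).snd = 0 := rfl
@[simp] lemma add_fst (a b : Extension D) : (a + b).fst = a.fst + b.fst := rfl
@[simp] lemma add_snd (a b : Extension D) : (a + b).snd = a.snd + b.snd := rfl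
@[simp] lemma neg_fst (a : Extension D) : (-a).fst = -a.fst := rfl
@[simp] lemma neg_snd (a : Extension D) : (-a).snd = -a.snd := rfl
@[simp] lemma mul_fst (a b : Extension D) : (a * b).fst = a.fst * b.fst
    + algebraMap k A (a.snd * b.snd) * D.q + algebraMap k A a.snd * D.τ b.fst
    + algebraMap k A b.snd * D.τ a.fst := rfl
@[simp] lemma mul_snd (a b : Extension D) :
    (a * b).snd = a.snd * D.ε b.fst + b.snd * D.ε a.fst := rfl

lemma τ_one : D.τ 1 = 0 := by
  simpa using D.τ_mul 1 1

lemma τ_algebraMap (c : k) : D.τ (algebraMap k A c) = 0 := by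
  rw [Algebra.algebraMap_eq_smul_one, map_smul, τ_one, smul_zero]

lemma ε_algebraMap (c : k) : D.ε (algebraMap k A c) = c := by simp

lemma mul_comm' (a b : Extension D) : a * b = b * a := by
  ext
  · simp only [mul_fst, map_mul]; ring
  · simp only [mul_snd]; ring

lemma mul_assoc' (a b c : Extension D) : a * b * c = a * (b * c) := by
  -- Both sides compute τ(ab) = τ(ba); this symmetry is what associativity needs beyond the rules
  -- for τ ∘ τ and ε ∘ τ.
  have key : ∀ (a b : A), a * D.τ b + algebraMap k A (D.ε b) * D.τ a =
      b * D.τ a + algebraMap k A (D.ε a) * D.τ b := fun a b => by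
    rw [← D.τ_mul, ← D.τ_mul, mul_comm]
  ext
  · simp only [mul_fst, mul_snd, map_mul, map_add, τ_algebraMap, ε_algebraMap, D.τ_τ, D.τ_mul,
      D.ε_τ, map_zero]
    linear_combination -algebraMap k A b.snd * key a.fst c.fst
      - algebraMap k A a.snd * key b.fst c.fst
  · simp only [mul_fst, mul_snd, map_mul, map_add, D.ε_τ, ε_algebraMap]
    ring

instance : CommRing (Extension D) where
  add_assoc a b c := by ext <;> simp [add_assoc]
  zero_add a := by ext <;> simp
  add_zero a := by ext <;> simp
  add_comm a b := by ext <;> simp [add_comm]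
  neg_add_cancel a := by ext <;> simp
  nsmul := nsmulRec
  zsmul := zsmulRec
  mul_assoc := mul_assoc'
  mul_comm := mul_comm'
  one_mul a := by ext <;> simp [τ_one]
  mul_one a := by ext <;> simp [τ_one]
  zero_mul a := by ext <;> simp
  mul_zero a := by ext <;> simp
  left_distrib a b c := by ext <;> simp <;> ring
  right_distrib a b c := by ext <;> simp <;> ring

/-- The inclusion of `A` into `A + k W`. -/
def inl : A →+* Extension D where
  toFun a := ⟨a, 0⟩
  map_one' := rfl
  map_zero' := rfl
  map_mul' a b := by ext <;> simp
  map_add' a b := by ext <;> simp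

instance : Algebra k (Extension D) := (inl.comp (algebraMap k A)).toAlgebra

/-- The inclusion of `A` into `A + k W`, as a homomorphism of algebras. -/
def inlHom (D : ExtensionData k A) : A →ₐ[k] Extension D := { inl with commutes' := fun _ => rfl }

lemma inlHom_injective : Function.Injective (inlHom D) := fun _ _ h => congrArg fst h

/-- The new element. -/
def W (D : ExtensionData k A) : Extension D := ⟨0, 1⟩

lemma inlHom_mul_W {a : A} (ha : D.ε a = 0) : inlHom D a * W D = inlHom D (D.τ a) := by
  ext <;> simp [inlHom, inl, W, ha]

lemma W_mul_W : W D * W D = inlHom D D.q := by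
  ext <;> simp [inlHom, inl, W]

end Extension

/-- Commuting matrices `!![v i, p i; 0, 0]` give the algebra homomorphism from a polynomial ring
whose upper right entry is the multiplication by the new element. -/
lemma exists_upperTriangular {ι : Type*} (v p : ι → A) (h : ∀ i j, v i * p j = v j * p i) :
    ∃ F : MvPolynomial ι k →ₐ[k] Matrix (Fin 2) (Fin 2) A,
      ∀ i, F (X i) = !![v i, p i; 0, 0] := by
  let s : Set (Matrix (Fin 2) (Fin 2) A) := Set.range fun i => !![v i, p i; 0, 0]
  have hs : ∀ a ∈ s, ∀ b ∈ s, a * b = b * a := by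
    rintro _ ⟨i, rfl⟩ _ ⟨j, rfl⟩
    simp [h i j, mul_comm]
  -- Evaluation of polynomials needs a commutative target, so it takes place in the subalgebra
  -- generated by the commuting matrices.
  let _ : CommRing (Algebra.adjoin k s) :=
    { (inferInstance : Ring (Algebra.adjoin k s)) with
      mul_comm := (Algebra.isMulCommutative_adjoin k hs).is_comm.comm }
  exact ⟨(Algebra.adjoin k s).val.comp
    (aeval fun i => ⟨!![v i, p i; 0, 0], Algebra.subset_adjoin ⟨i, rfl⟩⟩), fun i => by simp⟩

variable {ι : Type*} [Fintype ι]

/-- The ideal of a polynomial ring generated by elements `∑ j, r m j * X j` and the relations on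
the variables forced by the existence of an element `W` with `X i * W = p i = ∑ j, c i j * X j` and
`W ^ 2 = q`. -/
def extensionIdeal {κ : Type*} (r : κ → ι → MvPolynomial ι k) (c : ι → ι → MvPolynomial ι k)
    (q : MvPolynomial ι k) : Ideal (MvPolynomial ι k) :=
  Ideal.span (Set.range (fun m => ∑ j, r m j * X j) ∪
    (Set.range (fun ij : ι × ι =>
      X ij.1 * (∑ l, c ij.2 l * X l) - X ij.2 * ∑ l, c ij.1 l * X l) ∪
    Set.range fun i => X i * q - ∑ j, c i j * ∑ l, c j l * X l))

/-- The algebra defined by these relations has an extension by such an element `W`, provided that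
the given relations remain valid after multiplication by `W`. -/
lemma exists_extensionData {κ : Type*} (r : κ → ι → MvPolynomial ι k)
    (c : ι → ι → MvPolynomial ι k) (q : MvPolynomial ι k)
    (hr : ∀ m, ∑ j, r m j * ∑ l, c j l * X l ∈ extensionIdeal r c q) :
    ∃ D : ExtensionData k (MvPolynomial ι k ⧸ extensionIdeal r c q),
      D.q = Ideal.Quotient.mk _ q ∧
      (∀ g, D.ε (Ideal.Quotient.mk _ g) = constantCoeff g) ∧
      ∀ i, D.τ (Ideal.Quotient.mk _ (X i)) = Ideal.Quotient.mk _ (∑ j, c i j * X j) := by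
  set I := extensionIdeal r c q with hI
  set p : ι → MvPolynomial ι k := fun i => ∑ j, c i j * X j with hp
  let mk : MvPolynomial ι k →ₐ[k] MvPolynomial ι k ⧸ I := Ideal.Quotient.mkₐ k I
  have hmk : Function.Surjective mk := Ideal.Quotient.mkₐ_surjective k I
  have hk1 : ∀ i j, mk (X i) * mk (p j) = mk (X j) * mk (p i) := fun i j => by
    rw [← map_mul, ← map_mul]
    exact Ideal.Quotient.eq.mpr (Ideal.subset_span (Or.inr (Or.inl ⟨(i, j), rfl⟩)))
  have hk2 : ∀ i, mk (X i) * mk q = ∑ j, mk (c i j) * mk (p j) := fun i => by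
    simp only [← map_mul, ← map_sum]
    exact Ideal.Quotient.eq.mpr (Ideal.subset_span (Or.inr (Or.inr ⟨i, rfl⟩)))
  have hεp : ∀ i, constantCoeff (p i) = 0 := fun i => by simp [hp]
  -- F g has rows (g, T g) and (0, ε g). Multiplicativity of F is then the twisted Leibniz rule
  -- `hT`, as required of the A-component T g of g W.
  obtain ⟨F, hF⟩ := exists_upperTriangular (k := k) (fun i => mk (X i)) (fun i => mk (p i)) hk1
  have hF' : ∀ g, F g 0 0 = mk g ∧ F g 1 0 = 0 ∧
      F g 1 1 = algebraMap k _ (constantCoeff g) := by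
    intro g
    induction g using MvPolynomial.induction_on with
    | C a =>
      rw [algHom_C, algHom_C, constantCoeff_C]
      simp [Matrix.algebraMap_matrix_apply]
    | add g h hg hh => simp [hg, hh]
    | mul_X g i hg =>
      simp only [map_mul, Matrix.mul_apply, Fin.sum_univ_two, hF]
      simp [hg]
  let T : MvPolynomial ι k →ₗ[k] MvPolynomial ι k ⧸ I :=
    { toFun g := F g 0 1
      map_add' g h := by simp
      map_smul' a g := by simp }
  have hTX : ∀ i, T (X i) = mk (p i) := fun i => by simp [T, hF]
  have hT : ∀ g h, T (g * h) = mk g * T h + algebraMap k _ (constantCoeff h) * T g := by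
    intro g h
    simp only [T, LinearMap.coe_mk, AddHom.coe_mk, map_mul, Matrix.mul_apply, Fin.sum_univ_two,
      hF']
    ring
  have hTp : ∀ i, T (p i) = mk (X i) * mk q := fun i => by
    rw [hk2]
    simp only [hp, map_sum, hT, hTX, constantCoeff_X, map_zero, zero_mul, add_zero]
  -- T and ε descend to the quotient. On the given relations this is `hr`; on the other two families
  -- T gives p_j p_i - p_i p_j and q p_i - q p_i.
  have hgen : ∀ g ∈ I, constantCoeff g = 0 ∧ T g = 0 := by
    intro g hg
    induction hg using Submodule.span_induction with
    | mem x hx =>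
      rcases hx with ⟨m, rfl⟩ | ⟨⟨i, j⟩, rfl⟩ | ⟨i, rfl⟩
      · refine ⟨by simp, ?_⟩
        have h' : mk (∑ j, r m j * p j) = 0 := Ideal.Quotient.eq_zero_iff_mem.mpr (hr m)
        rw [← h']
        simp only [map_sum, map_mul, hT, hTX, constantCoeff_X, map_zero, zero_mul, add_zero]
      · refine ⟨by simp, ?_⟩
        change T (X i * p j - X j * p i) = 0
        rw [map_sub, mul_comm (X i), mul_comm (X j), hT, hT, hTX, hTX]
        simp only [constantCoeff_X, map_zero, zero_mul, add_zero]
        ring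
      · refine ⟨by simp, ?_⟩
        change T (X i * q - ∑ j, c i j * p j) = 0
        have : mk (p i) = ∑ j, mk (c i j) * mk (X j) := by simp only [hp, map_sum, map_mul]
        have h' : T (∑ j, c i j * p j) = ∑ j, mk (c i j) * (mk (X j) * mk q) := by
          rw [map_sum]
          exact Finset.sum_congr rfl fun j _ => by simp [hT, hεp, hTp]
        rw [map_sub, mul_comm (X i), hT, hTX, h', this, constantCoeff_X, map_zero, zero_mul,
          add_zero, Finset.mul_sum, ← Finset.sum_sub_distrib]
        exact Finset.sum_eq_zero fun j _ => by ring
    | zero => simp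
    | add x y _ _ hx hy => simp [hx, hy]
    | smul a x _ hx => simp [hx, hT, smul_eq_mul]
  let ε : (MvPolynomial ι k ⧸ I) →ₐ[k] k := Ideal.Quotient.liftₐ I (aeval fun _ => 0)
    fun g hg => by
      rw [aeval_zero']; simp [(hgen g hg).1]
  let τ : (MvPolynomial ι k ⧸ I) →ₗ[k] (MvPolynomial ι k ⧸ I) :=
    ((LinearMap.ker mk.toLinearMap).liftQ T fun g hg =>
      (hgen g (Ideal.Quotient.eq_zero_iff_mem.mp hg)).2) ∘ₗ
      (mk.toLinearMap.quotKerEquivOfSurjective hmk).symm.toLinearMap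
  have hτ : ∀ g, τ (mk g) = T g := fun g => by
    have : (mk.toLinearMap.quotKerEquivOfSurjective hmk).symm (mk g) =
        (LinearMap.ker mk.toLinearMap).mkQ g := by
      rw [LinearEquiv.symm_apply_eq]; rfl
    simp only [τ, LinearMap.comp_apply, LinearEquiv.coe_coe, this]
    rfl
  have hε : ∀ g, ε (mk g) = constantCoeff g := fun g => by
    change aeval (fun _ => (0 : k)) g = _
    rw [aeval_zero']; rfl
  have hετ : ∀ g, ε (T g) = 0 := fun g => by
    induction g using MvPolynomial.induction_on with
    | C a =>
      have h1 : T 1 = 0 := by simpa using hT 1 1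
      rw [C_eq_smul_one, map_smul, h1, smul_zero, map_zero]
    | add g h hg hh => simp [hg, hh]
    | mul_X g i hg => simp [hT, hTX, hε, hεp]
  refine ⟨⟨ε, τ, mk q, ?_, ?_, ?_⟩, rfl, hε, fun i => (hτ _).trans (hTX i)⟩
  · intro a b
    obtain ⟨g, rfl⟩ := hmk a
    obtain ⟨h, rfl⟩ := hmk b
    rw [← map_mul, hτ, hτ, hτ, hε, hT]
  · intro a
    obtain ⟨g, rfl⟩ := hmk a
    rw [hτ, hε]
    induction g using MvPolynomial.induction_on with
    | C a =>
      have h1 : T 1 = 0 := by simpa using hT 1 1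
      rw [constantCoeff_C, algHom_C, sub_self, mul_zero, C_eq_smul_one, map_smul, h1, smul_zero,
        map_zero]
    | add g h hg hh => rw [map_add, map_add, hg, hh, map_add, map_add, map_add]; ring
    | mul_X g i hg =>
      have h2 : ∀ a b, τ (mk a * b) = mk a * τ b + algebraMap k _ (ε b) * T a := by
        intro a b
        obtain ⟨b, rfl⟩ := hmk b
        rw [← map_mul, hτ, hτ, hε, hT]
      rw [mul_comm g, hT, hTX, map_add, h2, hg, hετ, ← algHom_C mk, h2, hτ, hTp, hε,
        hεp]
      simp only [map_mul, constantCoeff_X, map_zero, zero_mul]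
      ring
  · intro a
    obtain ⟨g, rfl⟩ := hmk a
    rw [hτ, hετ]

end Extension

/-! ### The algebra generated by the quadrics `xy`, `xz`, `yz`, `x² - z²`, `y² - z²`

Throughout, `v` lists elements `x, y, z, a, b, c, d, e` of an algebra; the last five stand for the
quadrics `xy`, `xz`, `yz`, `x² - z²`, `y² - z²` in degree one of a Rees algebra, and the missing
quadric `z²` multiplies all eight of them into the subalgebra they generate. -/

section Core

variable {B : Type*} [CommRing B]

/-- The coefficients of the linear relations between the five quadrics. -/
def linCoeff (v : Fin 8 → B) : Matrix (Fin 5) (Fin 3) B :=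
  !![v 5, 0, -v 3; v 5, -v 4, 0; -v 7, v 3, -v 4; v 3, -v 6, -v 5; v 4, -v 5, v 7 - v 6]

/-- The linear relations between the five quadrics. -/
def linRel (v : Fin 8 → B) (m : Fin 5) : B :=
  linCoeff v m 0 * v 0 + linCoeff v m 1 * v 1 + linCoeff v m 2 * v 2

/-- The products of the eight generators with `z²`. -/
def mulW (v : Fin 8 → B) : Fin 8 → B :=
  ![v 2 * v 4, v 2 * v 5, v 0 * v 4 - v 2 * v 6, v 4 * v 5, v 3 * v 5 - v 4 * v 7,
    v 3 * v 4 - v 5 * v 6, v 3 * v 3 - v 5 * v 5 - v 6 * v 7, v 3 * v 3 - v 4 * v 4 - v 7 * v 6]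

/-- A coefficient matrix for `mulW`. -/
def mulWCoeff (v : Fin 8 → B) : Matrix (Fin 8) (Fin 8) B :=
  !![0, 0, 0, 0, v 2, 0, 0, 0;
     0, 0, 0, 0, 0, v 2, 0, 0;
     0, 0, 0, 0, v 0, 0, -v 2, 0;
     0, 0, 0, 0, 0, v 4, 0, 0;
     0, 0, 0, 0, 0, v 3, 0, -v 4;
     0, 0, 0, 0, v 3, 0, -v 5, 0;
     0, 0, 0, v 3, 0, -v 5, 0, -v 6;
     0, 0, 0, v 3, -v 4, 0, -v 7, 0]

/-- The square of `z²`. -/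
def sqW (v : Fin 8 → B) : B := v 4 * v 4 + v 5 * v 5 - v 3 * v 3 + v 6 * v 7

lemma sum_mulWCoeff (v : Fin 8 → B) (i : Fin 8) : ∑ j, mulWCoeff v i j * v j = mulW v i := by
  fin_cases i <;> simp [mulWCoeff, mulW, Fin.sum_univ_eight] <;> ring

lemma map_linRel {B' : Type*} [CommRing B'] (f : B →+* B') (v : Fin 8 → B) (m : Fin 5) :
    f (linRel v m) = linRel (f ∘ v) m := by
  fin_cases m <;> simp [linRel, linCoeff]

lemma map_mulW {B' : Type*} [CommRing B'] (f : B →+* B') (v : Fin 8 → B) (i : Fin 8) :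
    f (mulW v i) = mulW (f ∘ v) i := by
  fin_cases i <;> simp [mulW]

lemma map_mulWCoeff {B' : Type*} [CommRing B'] (f : B →+* B') (v : Fin 8 → B) (i j : Fin 8) :
    f (mulWCoeff v i j) = mulWCoeff (f ∘ v) i j := by
  fin_cases i <;> fin_cases j <;> simp [mulWCoeff]

lemma map_sqW {B' : Type*} [CommRing B'] (f : B →+* B') (v : Fin 8 → B) :
    f (sqW v) = sqW (f ∘ v) := by
  simp [sqW]

/-- The linear relations stay valid after multiplication by `z²`. -/
lemma linCoeff_mulW (v : Fin 8 → B) (h : ∀ m, linRel v m = 0) (m : Fin 5) :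
    linCoeff v m 0 * mulW v 0 + linCoeff v m 1 * mulW v 1 + linCoeff v m 2 * mulW v 2 = 0 := by
  have l0 := h 0
  have l1 := h 1
  have l2 := h 2
  have l3 := h 3
  have l4 := h 4
  simp [linRel, linCoeff] at l0 l1 l2 l3 l4
  fin_cases m <;> simp [linCoeff, mulW]
  · linear_combination (-v 6) * l0 + v 6 * l1 - v 4 * l3
  · ring
  · linear_combination (-v 5) * l0 + v 5 * l1 - v 4 * l4
  · linear_combination (-v 4) * l0
  · linear_combination (-v 3) * l1 - v 4 * l2 + v 5 * l3 - v 6 * l4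

variable (k : Type*) [Field k]

/-- The generators `x, y, z, xyt, xzt, yzt, (x² - z²)t, (y² - z²)t` of the Rees algebra. -/
def reesGens : Fin 8 → Polynomial (MvPolynomial (Fin 3) k) :=
  ![Polynomial.C (X 0), Polynomial.C (X 1), Polynomial.C (X 2),
    Polynomial.monomial 1 (X 0 * X 1), Polynomial.monomial 1 (X 0 * X 2),
    Polynomial.monomial 1 (X 1 * X 2), Polynomial.monomial 1 (X 0 * X 0 - X 2 * X 2),
    Polynomial.monomial 1 (X 1 * X 1 - X 2 * X 2)]

variable {k}

/-- The symmetric matrix holds the six products x_i x_j t, with x²t and y²t recovered as (x² - z²)t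
+ W and (y² - z²)t + W. After W is eliminated by `hW`, the linear syzygies suffice. -/
lemma veronese_relation_linear {v : Fin 8 → B} {W : B} (hW : ∀ i, v i * W = mulW v i)
    (hl : ∀ m, linRel v m = 0) (i j l : Fin 3) :
    ![v 0, v 1, v 2] i * ![![v 6 + W, v 3, v 4], ![v 3, v 7 + W, v 5], ![v 4, v 5, W]] j l =
      ![v 0, v 1, v 2] j *
        ![![v 6 + W, v 3, v 4], ![v 3, v 7 + W, v 5], ![v 4, v 5, W]] i l := by
  have l0 := hl 0
  have l1 := hl 1
  have l2 := hl 2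
  have l3 := hl 3
  have l4 := hl 4
  have w0 := hW 0
  have w1 := hW 1
  have w2 := hW 2
  simp [linRel, linCoeff] at l0 l1 l2 l3 l4
  simp [mulW] at w0 w1 w2
  clear hW hl
  fin_cases i <;> fin_cases j <;> try rfl
  all_goals fin_cases l <;> simp <;> grind

/-- Here no syzygy is needed: the products with W in `hW` and `hWW` were read off from the 2 × 2
minors of the same symmetric matrix. -/
lemma veronese_relation_quadratic {v : Fin 8 → B} {W : B} (hW : ∀ i, v i * W = mulW v i)
    (hWW : W * W = sqW v) (i j l m : Fin 3) :
    ![![v 6 + W, v 3, v 4], ![v 3, v 7 + W, v 5], ![v 4, v 5, W]] i j *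
        ![![v 6 + W, v 3, v 4], ![v 3, v 7 + W, v 5], ![v 4, v 5, W]] l m =
      ![![v 6 + W, v 3, v 4], ![v 3, v 7 + W, v 5], ![v 4, v 5, W]] i l *
        ![![v 6 + W, v 3, v 4], ![v 3, v 7 + W, v 5], ![v 4, v 5, W]] j m := by
  have w3 := hW 3
  have w4 := hW 4
  have w5 := hW 5
  have w6 := hW 6
  have w7 := hW 7
  simp [mulW] at w3 w4 w5 w6 w7
  simp only [sqW] at hWW
  clear hW
  fin_cases j <;> fin_cases l <;> try rfl
  all_goals fin_cases i <;> fin_cases m <;> simp <;> grind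

lemma aeval_eq_zero_of_mulW [Algebra k B] {v : Fin 8 → B} {W : B}
    (hW : ∀ i, v i * W = mulW v i) (hWW : W * W = sqW v) (hl : ∀ m, linRel v m = 0)
    {g : MvPolynomial (Fin 8) k} (hg : aeval (reesGens k) g = 0) : aeval v g = 0 := by
  let ξ : Fin 3 → B := ![v 0, v 1, v 2]
  let S : Fin 3 → Fin 3 → B :=
    ![![v 6 + W, v 3, v 4], ![v 3, v 7 + W, v 5], ![v 4, v 5, W]]
  -- The substitution expresses the eight generators by Veronese coordinates, so that both
  -- evaluations factor through it.
  let h : MvPolynomial (Fin 8) k →ₐ[k] MvPolynomial (Fin 3 ⊕ Fin 3 × Fin 3) k :=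
    aeval ![X (Sum.inl 0), X (Sum.inl 1), X (Sum.inl 2), X (Sum.inr (0, 1)), X (Sum.inr (0, 2)),
      X (Sum.inr (1, 2)), X (Sum.inr (0, 0)) - X (Sum.inr (2, 2)),
      X (Sum.inr (1, 1)) - X (Sum.inr (2, 2))]
  have e1 : (veroneseMap (Fin 3) k).comp h = aeval (reesGens k) := by
    ext1 i
    fin_cases i <;> simp [h, veroneseMap, reesGens]
  have e2 : (aeval (Sum.elim ξ fun ij => S ij.1 ij.2)).comp h = aeval v := by
    ext1 i
    fin_cases i <;> simp [h, ξ, S]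
  rw [← e2, AlgHom.comp_apply]
  refine aeval_eq_zero_of_veroneseMap_eq_zero ?_ (veronese_relation_linear hW hl)
    (veronese_relation_quadratic hW hWW) ?_
  · intro i j
    fin_cases i <;> fin_cases j <;> rfl
  · rw [← hg, ← e1]; rfl

variable (k)

/-- The ideal of relations between the generators of the Rees algebra. -/
def reesGensIdeal : Ideal (MvPolynomial (Fin 8) k) :=
  extensionIdeal (fun m j => ![linCoeff X m 0, linCoeff X m 1, linCoeff X m 2, 0, 0, 0, 0, 0] j)
    (mulWCoeff X) (sqW X)

variable {k}

/-- The quotient by `reesGensIdeal` embeds into its extension by W, where every relation of the Rees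
algebra holds by `aeval_eq_zero_of_mulW`. -/
lemma mem_reesGensIdeal_of_aeval_eq_zero {g : MvPolynomial (Fin 8) k}
    (hg : aeval (reesGens k) g = 0) : g ∈ reesGensIdeal k := by
  have hlin : ∀ m, linRel (fun i => Ideal.Quotient.mk (reesGensIdeal k) (X i)) m = 0 := by
    intro m
    have := map_linRel (Ideal.Quotient.mk (reesGensIdeal k)) X m
    refine this.symm.trans (Ideal.Quotient.eq_zero_iff_mem.mpr (Ideal.subset_span (Or.inl ⟨m, ?_⟩)))
    simp [Fin.sum_univ_eight, linRel]
  obtain ⟨D, hq, hε, hτ⟩ := exists_extensionData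
    (fun m j => ![linCoeff X m 0, linCoeff X m 1, linCoeff X m 2, 0, 0, 0, 0, 0] j)
    (mulWCoeff (X : Fin 8 → MvPolynomial (Fin 8) k)) (sqW X) (by
      intro m
      rw [← reesGensIdeal, ← Ideal.Quotient.eq_zero_iff_mem,
        ← linCoeff_mulW _ hlin m]
      simp only [sum_mulWCoeff]
      simp [Fin.sum_univ_eight, map_mulW]
      fin_cases m <;> simp [linCoeff] <;> rfl)
  let f : MvPolynomial (Fin 8) k →ₐ[k] Extension D :=
    (Extension.inlHom D).comp (Ideal.Quotient.mkₐ k _)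
  let W := Extension.W D
  have hW : ∀ i, f (X i) * W = mulW (fun i => f (X i)) i := by
    intro i
    have h := Extension.inlHom_mul_W (D := D) (a := Ideal.Quotient.mk _ (X i)) (by simp [hε])
    rw [hτ, sum_mulWCoeff] at h
    exact h.trans (map_mulW f.toRingHom X i)
  have hWW : W * W = sqW fun i => f (X i) := by
    have h := Extension.W_mul_W (D := D)
    rw [hq] at h
    exact h.trans (map_sqW f.toRingHom X)
  have hl : ∀ m, linRel (fun i => f (X i)) m = 0 := by
    intro m
    exact (map_linRel (Extension.inlHom D).toRingHom
      (fun i => Ideal.Quotient.mk (reesGensIdeal k) (X i)) m).symm.trans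
        ((congrArg _ (hlin m)).trans (map_zero _))
  have hker := aeval_eq_zero_of_mulW hW hWW hl hg
  have hf : aeval (fun i => f (X i)) = f := by ext1 i; simp
  rw [hf] at hker
  have hz : Ideal.Quotient.mk _ g = 0 :=
    Extension.inlHom_injective (hker.trans (map_zero (Extension.inlHom D)).symm)
  exact Ideal.Quotient.eq_zero_iff_mem.mp hz

/-- The relations involving one of x, y, z are consequences of the linear syzygies. The ten
relations among the five quadrics alone do not involve x, y, z and are combinations of the minors.
-/
lemma mul_mulW_comm_of_lt {v : Fin 8 → B} (hl : ∀ m, linRel v m = 0)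
    (hm : ∀ a b c : Fin 5, ((linCoeff v).submatrix ![a, b, c] id).det = 0) {i j : Fin 8}
    (hij : i < j) : v i * mulW v j = v j * mulW v i := by
  have l0 := hl 0
  have l1 := hl 1
  have l2 := hl 2
  have l3 := hl 3
  have l4 := hl 4
  have m012 := hm 0 1 2
  have m013 := hm 0 1 3
  have m014 := hm 0 1 4
  have m023 := hm 0 2 3
  have m034 := hm 0 3 4
  have m124 := hm 1 2 4
  have m234 := hm 2 3 4
  simp [linRel, linCoeff] at l0 l1 l2 l3 l4
  rw [Matrix.det_fin_three] at m012 m013 m014 m023 m034 m124 m234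
  simp [linCoeff] at m012 m013 m014 m023 m034 m124 m234
  clear hl hm
  fin_cases i <;> fin_cases j <;> first | (exfalso; revert hij; decide) | skip
  all_goals clear hij; simp [mulW]
  · linear_combination v 2 * l1
  · linear_combination v 1 * l0 + v 2 * l2 + v 0 * l4
  · linear_combination v 4 * l0
  · linear_combination v 3 * l1 + v 4 * l2
  · linear_combination -v 6 * l1 + v 4 * l3
  · linear_combination -v 5 * l0 + v 6 * l2 + v 3 * l3
  · linear_combination -v 5 * l0 + v 5 * l1 + v 6 * l2 + v 3 * l3 - v 4 * l4
  · linear_combination v 0 * l0 - v 0 * l1 + v 2 * l3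
  · linear_combination v 5 * l0 - v 5 * l1
  · linear_combination v 7 * l1 + v 5 * l2
  · linear_combination -v 3 * l1 + v 5 * l3
  · linear_combination -v 4 * l0 + v 3 * l2 + v 7 * l3 + v 5 * l4
  · linear_combination -v 4 * l0 + v 4 * l1 + v 3 * l2 + v 7 * l3
  · linear_combination -v 6 * l0 + v 6 * l1 - v 4 * l3
  · linear_combination -v 5 * l0 + v 5 * l1 - v 4 * l4
  · linear_combination -v 4 * l0
  · linear_combination -v 3 * l0 + v 5 * l3 - v 6 * l4
  · linear_combination -v 3 * l0 + v 3 * l1 + v 4 * l2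
  · linear_combination -m012
  · linear_combination -m013
  · linear_combination m023
  · linear_combination m014 + m023
  · linear_combination -m014
  · linear_combination -m013
  · linear_combination -m013 - m124
  · linear_combination m034
  · linear_combination -m012
  · linear_combination m234

lemma mul_mulW_comm {v : Fin 8 → B} (hl : ∀ m, linRel v m = 0)
    (hm : ∀ a b c : Fin 5, ((linCoeff v).submatrix ![a, b, c] id).det = 0) (i j : Fin 8) :
    v i * mulW v j = v j * mulW v i := by
  rcases lt_trichotomy i j with h | rfl | h
  · exact mul_mulW_comm_of_lt hl hm h
  · rfl
  · exact (mul_mulW_comm_of_lt hl hm h).symm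

lemma mul_sqW {v : Fin 8 → B} (hl : ∀ m, linRel v m = 0)
    (hm : ∀ a b c : Fin 5, ((linCoeff v).submatrix ![a, b, c] id).det = 0) (i : Fin 8) :
    v i * sqW v = ∑ j, mulWCoeff v i j * mulW v j := by
  have l0 := hl 0
  have l1 := hl 1
  have l2 := hl 2
  have l3 := hl 3
  have l4 := hl 4
  have m012 := hm 0 1 2
  have m013 := hm 0 1 3
  have m023 := hm 0 2 3
  simp [linRel, linCoeff] at l0 l1 l2 l3 l4
  rw [Matrix.det_fin_three] at m012 m013 m023
  simp [linCoeff] at m012 m013 m023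
  clear hl hm
  fin_cases i <;> simp [mulW, mulWCoeff, sqW, Fin.sum_univ_eight]
  · linear_combination 2 * v 5 * l0 - v 5 * l1 - v 6 * l2 - v 3 * l3 + v 4 * l4
  · linear_combination 2 * v 4 * l0 - v 4 * l1 - v 3 * l2 - v 7 * l3 - v 5 * l4
  · linear_combination -v 3 * l1 - v 4 * l2
  · linear_combination -m023
  · linear_combination m013
  · linear_combination m012
  · ring
  · ring

/-- In an algebra in which the five linear relations hold and the maximal minors of their
coefficient matrix vanish, all relations of the Rees algebra hold. -/
theorem aeval_eq_zero_of_linRel [Algebra k B] {v : Fin 8 → B} (hl : ∀ m, linRel v m = 0)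
    (hm : ∀ a b c : Fin 5, ((linCoeff v).submatrix ![a, b, c] id).det = 0)
    {g : MvPolynomial (Fin 8) k} (hg : aeval (reesGens k) g = 0) : aeval v g = 0 := by
  have hv : ((aeval v : MvPolynomial (Fin 8) k →ₐ[k] B).toRingHom ∘ X) = v := by
    funext i; simp
  suffices reesGensIdeal k ≤ RingHom.ker (aeval v : MvPolynomial (Fin 8) k →ₐ[k] B).toRingHom from
    this (mem_reesGensIdeal_of_aeval_eq_zero hg)
  refine Ideal.span_le.mpr ?_
  rintro _ (⟨m, rfl⟩ | ⟨⟨i, j⟩, rfl⟩ | ⟨i, rfl⟩)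
  · have h := map_linRel (aeval v : MvPolynomial (Fin 8) k →ₐ[k] B).toRingHom X m
    rw [hv, hl] at h
    refine Eq.trans (congrArg _ ?_) h
    simp [Fin.sum_univ_eight, linRel]
  · simp only [sum_mulWCoeff, SetLike.mem_coe, RingHom.mem_ker, map_sub, map_mul, map_mulW, hv]
    simpa using sub_eq_zero.mpr (mul_mulW_comm hl hm i j)
  · simp only [sum_mulWCoeff, SetLike.mem_coe, RingHom.mem_ker, map_sub, map_mul, map_sum, map_mulW,
      map_mulWCoeff, map_sqW, hv]
    simpa using sub_eq_zero.mpr (mul_sqW hl hm i)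

end Core

/-! ### Minors of products of matrices -/

section Minors

variable {A : Type*} [CommRing A]

/-- Each row of N M is a combination of rows of M, so multilinearity expands a minor of N M into
minors of M. Terms with repeated rows need no separate treatment, as `minorsIdeal` admits them. -/
lemma minorsIdeal_mul_left_le {a b c : ℕ} (t : ℕ) (N : Matrix (Fin c) (Fin a) A)
    (M : Matrix (Fin a) (Fin b) A) : minorsIdeal t (N * M) ≤ minorsIdeal t M := by
  refine Ideal.span_le.mpr ?_
  rintro _ ⟨r, s, rfl⟩
  have h : (N * M).submatrix r s =
      fun i => ∑ j ∈ (Finset.univ : Finset (Fin a)), N (r i) j • fun l => M j (s l) := by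
    funext i l
    simp [Matrix.mul_apply, Finset.sum_apply]
  have h2 := (Matrix.detRowAlternating (n := Fin t) (R := A)).toMultilinearMap.map_sum_finset
    (fun i j => N (r i) j • fun l => M j (s l)) (fun _ => Finset.univ)
  have h3 : ((N * M).submatrix r s).det = _ := (congrArg Matrix.det h).trans h2
  rw [SetLike.mem_coe, h3]
  refine Ideal.sum_mem _ fun f _ => ?_
  have h4 := (Matrix.detRowAlternating (n := Fin t) (R := A)).toMultilinearMap.map_smul_univ
    (fun i => N (r i) (f i)) (fun i l => M (f i) (s l))
  rw [h4]
  exact Ideal.mul_mem_left _ _ (Ideal.subset_span ⟨f, s, rfl⟩)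

lemma minorsIdeal_transpose {a b : ℕ} (t : ℕ) (M : Matrix (Fin a) (Fin b) A) :
    minorsIdeal t M.transpose = minorsIdeal t M := by
  unfold minorsIdeal
  congr 1
  ext d
  constructor <;> rintro ⟨r, c, rfl⟩ <;>
    exact ⟨c, r, by rw [← Matrix.det_transpose]; rfl⟩

lemma minorsIdeal_mul_right_le {a b c : ℕ} (t : ℕ) (M : Matrix (Fin a) (Fin b) A)
    (N : Matrix (Fin b) (Fin c) A) : minorsIdeal t (M * N) ≤ minorsIdeal t M := by
  rw [← minorsIdeal_transpose, Matrix.transpose_mul, ← minorsIdeal_transpose t M]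
  exact minorsIdeal_mul_left_le t _ _

end Minors

/-! ### Pfaffians of 5 × 5 skew-symmetric matrices -/

section Pfaffians

variable {A : Type*} [CommRing A]

lemma pfaffians_eq (φ : Matrix (Fin 5) (Fin 5) A) : pfaffians φ =
    ![φ 1 2 * φ 3 4 - φ 1 3 * φ 2 4 + φ 1 4 * φ 2 3,
      -(φ 0 2 * φ 3 4 - φ 0 3 * φ 2 4 + φ 0 4 * φ 2 3),
      φ 0 1 * φ 3 4 - φ 0 3 * φ 1 4 + φ 0 4 * φ 1 3,
      -(φ 0 1 * φ 2 4 - φ 0 2 * φ 1 4 + φ 0 4 * φ 1 2),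
      φ 0 1 * φ 2 3 - φ 0 2 * φ 1 3 + φ 0 3 * φ 1 2] := by
  have h : ∀ i, pfaffians φ i = (-1) ^ (i : ℕ) * (φ (i.succAbove 0) (i.succAbove 1) *
      φ (i.succAbove 2) (i.succAbove 3) - φ (i.succAbove 0) (i.succAbove 2) *
      φ (i.succAbove 1) (i.succAbove 3) + φ (i.succAbove 0) (i.succAbove 3) *
      φ (i.succAbove 1) (i.succAbove 2)) := fun _ => rfl
  funext i
  rw [h]
  fin_cases i
  · exact (congrArg (· * _) (pow_zero _)).trans (one_mul _)
  · exact (congrArg (· * _) (pow_one _)).trans (neg_one_mul _)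
  · exact (congrArg (· * _) (neg_one_sq)).trans (one_mul _)
  · exact (congrArg (· * _) (show (-1 : A) ^ 3 = -1 by ring)).trans (neg_one_mul _)
  · exact (congrArg (· * _) (show (-1 : A) ^ 4 = 1 by ring)).trans (one_mul _)

/-- The Pfaffians of a skew-symmetric matrix satisfy the relations given by its columns. -/
lemma sum_pfaffians_mul {φ : Matrix (Fin 5) (Fin 5) A} (h : φ.transpose = -φ)
    (hd : ∀ i, φ i i = 0) (j : Fin 5) : ∑ i, pfaffians φ i * φ i j = 0 := by
  have hs : ∀ i j, φ i j = -φ j i := fun i j => congrFun (congrFun h j) i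
  have h10 := hs 1 0
  have h20 := hs 2 0
  have h30 := hs 3 0
  have h40 := hs 4 0
  have h21 := hs 2 1
  have h31 := hs 3 1
  have h41 := hs 4 1
  have h32 := hs 3 2
  have h42 := hs 4 2
  have h43 := hs 4 3
  rw [pfaffians_eq]
  fin_cases j <;> simp [Fin.sum_univ_five, hd, h10, h20, h30, h40, h21, h31, h41, h32, h42, h43] <;> ring

/-- If a skew-symmetric matrix annihilates a vector, the vector of its Pfaffians is proportional
to that vector. -/
lemma pfaffians_mul_comm_of_mulVec_eq_zero {φ : Matrix (Fin 5) (Fin 5) A} (h : φ.transpose = -φ)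
    (hd : ∀ i, φ i i = 0) (v : Fin 5 → A) (hv : ∀ i, ∑ j, φ i j * v j = 0) (i j : Fin 5) :
    pfaffians φ i * v j = pfaffians φ j * v i := by
  have hs : ∀ i j, φ i j = -φ j i := fun i j => congrFun (congrFun h j) i
  have h10 := hs 1 0
  have h20 := hs 2 0
  have h30 := hs 3 0
  have h40 := hs 4 0
  have h21 := hs 2 1
  have h31 := hs 3 1
  have h41 := hs 4 1
  have h32 := hs 3 2
  have h42 := hs 4 2
  have h43 := hs 4 3
  have v0 := hv 0
  have v1 := hv 1
  have v2 := hv 2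
  have v3 := hv 3
  have v4 := hv 4
  simp only [Fin.sum_univ_five, hd, h10, h20, h30, h40, h21, h31, h41, h32, h42, h43] at v0 v1 v2 v3 v4
  wlog hij : i < j generalizing i j
  · rcases (not_lt.mp hij).eq_or_lt with rfl | h
    · rfl
    · exact (this j i h).symm
  rw [pfaffians_eq]
  clear hs h hv hd h10 h20 h30 h40 h21 h31 h41 h32 h42 h43
  fin_cases i <;> fin_cases j <;> first | (exfalso; revert hij; decide) | skip
  all_goals
    clear hij
    simp
    grind

end Pfaffians

/-! ### Presentations of Rees algebras -/

section Rees

variable {A : Type*} [CommRing A] {m : ℕ}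

lemma range_aeval_monomial (f : Fin m → A) :
    (aeval (fun i => Polynomial.monomial 1 (f i)) :
      MvPolynomial (Fin m) A →ₐ[A] Polynomial A).range =
      reesAlgebra (Ideal.span (Set.range f)) := by
  rw [← Algebra.adjoin_range_eq_range_aeval, ← adjoin_monomial_eq_reesAlgebra]
  apply le_antisymm
  · apply Algebra.adjoin_mono
    rintro _ ⟨i, rfl⟩
    exact ⟨f i, Ideal.subset_span ⟨i, rfl⟩, rfl⟩
  · apply Algebra.adjoin_le
    rintro _ ⟨a, ha, rfl⟩
    induction ha using Submodule.span_induction with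
    | mem x hx =>
      obtain ⟨i, rfl⟩ := hx
      exact Algebra.subset_adjoin ⟨i, rfl⟩
    | zero => simp
    | add x y _ _ hx hy => rw [map_add]; exact add_mem hx hy
    | smul c x _ hx =>
      rw [map_smul]
      exact Subalgebra.smul_mem _ hx c

/-- The Rees algebra is the polynomial ring modulo its presentation ideal. -/
lemma exists_equiv_reesAlgebra (f : Fin m → A) {I : Ideal A} (hI : Ideal.span (Set.range f) = I)
    {D : Ideal (MvPolynomial (Fin m) A)} (hD : D = reesIdeal f) :
    ∃ e : (MvPolynomial (Fin m) A ⧸ D) ≃ₐ[A] reesAlgebra I,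
      ∀ i, (e (Ideal.Quotient.mk D (X i)) : Polynomial A) = Polynomial.monomial 1 (f i) := by
  subst hD hI
  refine ⟨(Ideal.quotientKerEquivRange _).trans
    (Subalgebra.equivOfEq _ _ (range_aeval_monomial f)), fun i => ?_⟩
  change aeval (fun i => Polynomial.monomial 1 (f i)) (X i : MvPolynomial (Fin m) A) = _
  rw [aeval_X]

end Rees

/-! ### The Jacobian dual and its relations -/

section JacobianDual

variable {k : Type*} [Field k] {n a b : ℕ}

lemma coeff_xDeriv (l : Fin n) (P : MvPolynomial (Fin a) (MvPolynomial (Fin n) k))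
    (e : Fin a →₀ ℕ) : coeff e (xDeriv l P) = pderiv l (coeff e P) := by
  classical
  rw [xDeriv, coeff_sum]
  simp only [coeff_monomial]
  rw [Finset.sum_ite_eq' P.support e]
  split_ifs with h
  · rfl
  · rw [notMem_support_iff.mp h, map_zero]

lemma xDeriv_TMul (φ : Matrix (Fin a) (Fin b) (MvPolynomial (Fin n) k)) (l : Fin n) (j : Fin b) :
    xDeriv l (TMul φ j) = ∑ i, X i * C (pderiv l (φ i j)) := by
  ext1 e
  rw [coeff_xDeriv, TMul, coeff_sum, coeff_sum, map_sum]
  refine Finset.sum_congr rfl fun i _ => ?_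
  classical
  rw [mul_comm (X i), mul_comm (X i), coeff_C_mul, coeff_C_mul, coeff_X]
  split_ifs <;> simp

/-- A linear form is determined by its (constant) partial derivatives. -/
lemma exists_linear_coeff {p : MvPolynomial (Fin n) k} (hp : p.IsHomogeneous 1) :
    ∃ c : Fin n → k, p = ∑ l, C (c l) * X l ∧ ∀ l, pderiv l p = C (c l) := by
  have h : p ∈ homogeneousSubmodule (Fin n) k 1 := hp
  rw [homogeneousSubmodule_one_eq_span_X, Submodule.mem_span_range_iff_exists_fun] at h
  obtain ⟨c, rfl⟩ := h
  refine ⟨c, by simp only [smul_eq_C_mul], fun l => ?_⟩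
  simp only [smul_eq_C_mul, map_sum, pderiv_C_mul, pderiv_X]
  rw [Finset.sum_eq_single l (fun i _ hi => by simp [Pi.single_eq_of_ne hi]) (by simp)]
  simp

lemma sum_jacobianDual_mul {φ : Matrix (Fin a) (Fin b) (MvPolynomial (Fin n) k)}
    (hφ : ∀ i j, (φ i j).IsHomogeneous 1) (j : Fin b) :
    ∑ l, jacobianDual φ j l * C (X l) = TMul φ j := by
  choose c hc hc' using fun i j => exists_linear_coeff (hφ i j)
  simp only [jacobianDual, Matrix.of_apply, xDeriv_TMul, Finset.sum_mul]
  rw [Finset.sum_comm, TMul]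
  refine Finset.sum_congr rfl fun i _ => ?_
  rw [hc i j, map_sum, Finset.mul_sum]
  refine Finset.sum_congr rfl fun l _ => ?_
  rw [← hc, hc', C_mul, mul_assoc]

lemma exists_jacobianDual_eq {φ : Matrix (Fin a) (Fin b) (MvPolynomial (Fin n) k)}
    (hφ : ∀ i j, (φ i j).IsHomogeneous 1) :
    ∃ Q : Matrix (Fin b) (Fin n) (MvPolynomial (Fin a) k), jacobianDual φ = Q.map (map C) := by
  choose c hc hc' using fun i j => exists_linear_coeff (hφ i j)
  refine ⟨Matrix.of fun j l => ∑ i, X i * C (c i j l), ?_⟩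
  ext1 j l
  simp [jacobianDual, xDeriv_TMul, hc']

lemma TMul_mem_reesIdeal {A : Type*} [CommRing A] {a b : ℕ} {φ : Matrix (Fin a) (Fin b) A}
    {f : Fin a → A} (hf : ∀ j, ∑ i, f i * φ i j = 0) (j : Fin b) : TMul φ j ∈ reesIdeal f := by
  have h : (aeval (fun i => Polynomial.monomial 1 (f i)) : _ →ₐ[A] Polynomial A) (TMul φ j) =
      Polynomial.monomial 1 (∑ i, f i * φ i j) := by
    simp only [TMul, map_sum, map_mul, aeval_X, algHom_C, Polynomial.algebraMap_apply,
      Algebra.algebraMap_self, RingHom.id_apply, Polynomial.monomial_mul_C]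
  rw [reesIdeal, RingHom.mem_ker, h, hf, map_zero]

/-- The ideal of the Jacobian dual consists of relations of the Rees algebra. -/
lemma dualIdeal_le_reesIdeal {φ : Matrix (Fin a) (Fin b) (MvPolynomial (Fin 3) k)}
    (hφ : ∀ i j, (φ i j).IsHomogeneous 1) {f : Fin a → MvPolynomial (Fin 3) k}
    (hf : ∀ j, ∑ i, f i * φ i j = 0) : dualIdeal φ ≤ reesIdeal f := by
  refine sup_le (Ideal.span_le.mpr ?_) (Ideal.span_le.mpr ?_)
  · rintro _ ⟨j, rfl⟩
    exact TMul_mem_reesIdeal hf j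
  · rintro _ ⟨r, c, rfl⟩
    -- An injective choice of columns is a permutation of all three. A repeated column makes the
    -- minor zero.
    by_cases hc : Function.Injective c
    · let e := Equiv.ofBijective c (Finite.injective_iff_bijective.mp hc)
      let π : MvPolynomial (Fin a) (MvPolynomial (Fin 3) k) →ₐ[MvPolynomial (Fin 3) k]
        Polynomial (MvPolynomial (Fin 3) k) := aeval fun i => Polynomial.monomial 1 (f i)
      change π _ = 0
      rw [AlgHom.map_det, ← Matrix.exists_mulVec_eq_zero_iff]
      -- The vector (x, y, z) is a nonzero kernel vector over the domain R[t], since ψ · x = T · φ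
      -- maps to zero.
      refine ⟨fun l => π (C (X (c l))), fun h => ?_, ?_⟩
      · have h0 := congrFun h 0
        simp only [π, algHom_C, Polynomial.algebraMap_apply, Algebra.algebraMap_self,
          RingHom.id_apply, Pi.zero_apply, Polynomial.C_eq_zero] at h0
        exact X_ne_zero _ h0
      · funext i
        simp only [Matrix.mulVec, dotProduct, AlgHom.mapMatrix_apply, Matrix.map_apply,
          Matrix.submatrix_apply, Pi.zero_apply]
        simp only [← map_mul, ← map_sum]
        have := e.sum_comp fun l => jacobianDual φ (r i) l * C (X l)
        rw [show (∑ l, jacobianDual φ (r i) (c l) * C (X (c l))) = _ from this,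
          sum_jacobianDual_mul hφ]
        exact TMul_mem_reesIdeal hf (r i)
    · obtain ⟨i, j, hij, hne⟩ : ∃ i j, c i = c j ∧ i ≠ j := by
        simpa [Function.Injective] using hc
      rw [SetLike.mem_coe, Matrix.det_zero_of_column_eq hne fun l => by simp [hij]]
      exact zero_mem _

/-- The entries of T · φ are linear in T, and ψ has entries in k[T] because φ is linear in x; so its
minors lie in k[T]. -/
lemma hasFiberTypeRelations_of_dualIdeal_eq {φ : Matrix (Fin a) (Fin b) (MvPolynomial (Fin n) k)}
    (hφ : ∀ i j, (φ i j).IsHomogeneous 1) {f : Fin a → MvPolynomial (Fin n) k}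
    (hf : dualIdeal φ = reesIdeal f) : HasFiberTypeRelations f := by
  apply le_antisymm
  · nth_rw 1 [← hf]
    refine sup_le_sup (Ideal.span_mono ?_) (Ideal.span_mono ?_)
    · rintro _ ⟨j, rfl⟩
      refine ⟨hf ▸ Ideal.mem_sup_left (Ideal.subset_span ⟨j, rfl⟩), ?_⟩
      refine IsHomogeneous.sum _ _ _ fun i _ => ?_
      simpa using (isHomogeneous_X (MvPolynomial (Fin n) k) i).mul (isHomogeneous_C _ (φ i j))
    · rintro _ ⟨r, c, rfl⟩
      refine ⟨hf ▸ Ideal.mem_sup_right (Ideal.subset_span ⟨r, c, rfl⟩), ?_⟩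
      obtain ⟨Q, hQ⟩ := exists_jacobianDual_eq hφ
      refine ⟨(Q.submatrix r c).det, ?_⟩
      rw [hQ, RingHom.map_det]
      rfl
  · exact sup_le (Ideal.span_le.mpr fun _ h => h.1) (Ideal.span_le.mpr fun _ h => h.1)

end JacobianDual

/-! ### Linear changes of coordinates -/

section LinearForms

variable {k : Type*} [Field k]

/-- The linear form with coefficients the `i`-th row of `m`. -/
def linForm {s n : ℕ} (m : Matrix (Fin s) (Fin n) k) (i : Fin s) : MvPolynomial (Fin n) k :=
  ∑ l, C (m i l) * X l

lemma isHomogeneous_linForm {s n : ℕ} (m : Matrix (Fin s) (Fin n) k) (i : Fin s) :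
    (linForm m i).IsHomogeneous 1 :=
  IsHomogeneous.sum _ _ _ fun l _ => isHomogeneous_C_mul_X _ l

lemma aeval_linForm {s n : ℕ} {A : Type*} [CommRing A] [Algebra k A] (m : Matrix (Fin s) (Fin n) k)
    (v : Fin n → A) (i : Fin s) : aeval v (linForm m i) = ∑ l, algebraMap k A (m i l) * v l := by
  simp [linForm]

lemma pderiv_linForm {s n : ℕ} (m : Matrix (Fin s) (Fin n) k) (i : Fin s) (l : Fin n) :
    pderiv l (linForm m i) = C (m i l) := by
  simp only [linForm, map_sum, pderiv_C_mul, pderiv_X]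
  rw [Finset.sum_eq_single l (fun i _ hi => by simp [Pi.single_eq_of_ne hi]) (by simp)]
  simp

variable {d : ℕ} {m n : Matrix (Fin d) (Fin d) k}

lemma sum_mul_linForm (h : m * n = 1) (l : Fin d) : ∑ i, C (m l i) * linForm n i = X l := by
  simp only [linForm, Finset.mul_sum]
  rw [Finset.sum_comm]
  have : ∀ j, ∑ i, C (m l i) * (C (n i j) * X j) = C ((m * n) l j) * (X j : MvPolynomial _ k) := by
    intro j
    simp only [Matrix.mul_apply, map_sum, Finset.sum_mul, map_mul, mul_assoc]
  simp only [this, h]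
  rw [Finset.sum_eq_single l (fun j _ hj => by simp [Matrix.one_apply_ne hj.symm]) (by simp)]
  simp

lemma aeval_linForm_comp (h : m * n = 1) :
    (aeval (linForm n)).comp (aeval (linForm m)) = AlgHom.id k (MvPolynomial (Fin d) k) := by
  ext1 i
  simp only [AlgHom.comp_apply, aeval_X, aeval_linForm, AlgHom.id_apply]
  exact sum_mul_linForm h i

lemma aeval_linForm_injective (h : m * n = 1) :
    Function.Injective (aeval (linForm m) : MvPolynomial (Fin d) k →ₐ[k] _) :=
  Function.LeftInverse.injective (g := aeval (linForm n)) fun p =>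
    congrArg (fun f : _ →ₐ[k] _ => f p) (aeval_linForm_comp h)

lemma aeval_linForm_surjective (h : m * n = 1) :
    Function.Surjective (aeval (linForm m) : MvPolynomial (Fin d) k →ₐ[k] _) :=
  Function.RightInverse.surjective (g := aeval (linForm n)) fun p =>
    congrArg (fun f : _ →ₐ[k] _ => f p) (aeval_linForm_comp (mul_eq_one_comm.mp h))

lemma eval_mulVec_linForm (h : m * n = 1) (v : Fin d → k) (i : Fin d) :
    eval (n.mulVec v) (linForm m i) = v i := by
  have : eval (n.mulVec v) (linForm m i) = m.mulVec (n.mulVec v) i := by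
    simp [linForm, Matrix.mulVec, dotProduct]
  rw [this, Matrix.mulVec_mulVec, h, Matrix.one_mulVec]

/-- Every linear form is a combination of independent linear forms. -/
lemma exists_linForm_coeff (h : m * n = 1) {p : MvPolynomial (Fin d) k} (hp : p.IsHomogeneous 1) :
    ∃ c : Fin d → k, p = ∑ r, C (c r) * linForm m r := by
  obtain ⟨c, hc, -⟩ := exists_linear_coeff hp
  refine ⟨fun r => ∑ l, c l * n l r, ?_⟩
  simp only [hc, map_sum, Finset.sum_mul, map_mul]
  rw [Finset.sum_comm]
  refine Finset.sum_congr rfl fun l _ => ?_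
  rw [← sum_mul_linForm (mul_eq_one_comm.mp h) l, Finset.mul_sum]
  exact Finset.sum_congr rfl fun r _ => (mul_assoc _ _ _).symm

end LinearForms

/-! ### Forms of the generating degree -/

section DegreeTwo

variable {k : Type*} [Field k] {n s d : ℕ}

lemma homogeneousComponent_mul_of_isHomogeneous {f : MvPolynomial (Fin n) k}
    (hf : f.IsHomogeneous d) (g : MvPolynomial (Fin n) k) :
    homogeneousComponent d (g * f) = C (constantCoeff g) * f := by
  induction g using MvPolynomial.induction_on' with
  | add p q hp hq => rw [add_mul, map_add, hp, hq, map_add, map_add, add_mul]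
  | monomial u a =>
    have h := (isHomogeneous_monomial (n := u.degree) a rfl).mul hf
    rw [homogeneousComponent_of_mem h]
    by_cases hu : u = 0
    · simp [hu]
    · have : u.degree ≠ 0 := by simpa [Finsupp.degree_eq_zero_iff] using hu
      rw [if_neg (by omega), constantCoeff_monomial, if_neg hu, map_zero, zero_mul]

/-- A form in an ideal generated by forms of the same degree is a combination of the generators
with constant coefficients. -/
lemma exists_coeff_of_mem_span {f : Fin s → MvPolynomial (Fin n) k}
    (hf : ∀ i, (f i).IsHomogeneous d) {g : MvPolynomial (Fin n) k} (hg : g.IsHomogeneous d)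
    (h : g ∈ Ideal.span (Set.range f)) : ∃ c : Fin s → k, g = ∑ i, C (c i) * f i := by
  obtain ⟨c, rfl⟩ := Ideal.mem_span_range_iff_exists_fun.mp h
  refine ⟨fun i => constantCoeff (c i), ?_⟩
  rw [← homogeneousComponent_eq_self hg, map_sum]
  exact Finset.sum_congr rfl fun i _ => homogeneousComponent_mul_of_isHomogeneous (hf i) _

end DegreeTwo

/-! ### The five quadrics and their linear syzygies -/

section Quadrics

/-- The five quadrics `xy, xz, yz, x² - z², y² - z²`. -/
def quadrics {A : Type*} [CommRing A] (x : Fin 3 → A) : Fin 5 → A :=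
  ![x 0 * x 1, x 0 * x 2, x 1 * x 2, x 0 * x 0 - x 2 * x 2, x 1 * x 1 - x 2 * x 2]

variable {k : Type*} [Field k] {m n : Matrix (Fin 3) (Fin 3) k}

lemma isHomogeneous_quadrics (m : Matrix (Fin 3) (Fin 3) k) (i : Fin 5) :
    (quadrics (linForm m) i).IsHomogeneous 2 := by
  have h : ∀ a b, (linForm m a * linForm m b).IsHomogeneous 2 := fun a b =>
    (isHomogeneous_linForm m a).mul (isHomogeneous_linForm m b)
  fin_cases i
  · exact h 0 1
  · exact h 0 2
  · exact h 1 2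
  · exact (h 0 0).sub (h 2 2)
  · exact (h 1 1).sub (h 2 2)

/-- The five quadrics and `z²` are linearly independent. -/
lemma quadrics_independent (h : m * n = 1) (c : Fin 5 → k) (c' : k)
    (hc : ∑ i, C (c i) * quadrics (linForm m) i + C c' * (linForm m 2 * linForm m 2) = 0) :
    c = 0 ∧ c' = 0 := by
  -- At the point n · (x, y, z) the three linear forms take the values x, y, z.
  have key : ∀ x y z : k, c 0 * (x * y) + c 1 * (x * z) + c 2 * (y * z) + c 3 * (x * x - z * z) +
      c 4 * (y * y - z * z) + c' * (z * z) = 0 := by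
    intro x y z
    have := congrArg (eval (n.mulVec ![x, y, z])) hc
    simpa [Fin.sum_univ_five, quadrics, eval_mulVec_linForm h] using this
  have h3 : c 3 = 0 := by simpa using key 1 0 0
  have h4 : c 4 = 0 := by simpa using key 0 1 0
  have h5 : c' = 0 := by simpa [h3, h4] using key 0 0 1
  have h0 : c 0 = 0 := by simpa [h3, h4, h5] using key 1 1 0
  have h1 : c 1 = 0 := by simpa [h3, h4, h5] using key 1 0 1
  have h2 : c 2 = 0 := by simpa [h3, h4, h5] using key 0 1 1
  refine ⟨?_, h5⟩
  funext i
  fin_cases i <;> assumption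

/-- The linear syzygies of the five quadrics. -/
lemma syzygy_coeff (h2 : (2 : k) ≠ 0) (h : m * n = 1) (S : Fin 5 → Fin 3 → k)
    (hS : ∑ l, (∑ r, C (S l r) * linForm m r) * quadrics (linForm m) l = 0) :
    S 3 0 = 0 ∧ S 4 1 = 0 ∧ S 4 2 = -S 3 2 ∧ S 0 0 = -S 3 1 ∧ S 1 0 = -S 3 2 ∧ S 0 1 = -S 4 0 ∧
      S 2 1 = S 3 2 ∧ S 1 2 = S 4 0 ∧ S 2 2 = S 3 1 ∧ S 0 2 = -S 1 1 - S 2 0 := by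
  have key : ∀ x y z : k, (S 0 0 * x + S 0 1 * y + S 0 2 * z) * (x * y) +
      (S 1 0 * x + S 1 1 * y + S 1 2 * z) * (x * z) +
      (S 2 0 * x + S 2 1 * y + S 2 2 * z) * (y * z) +
      (S 3 0 * x + S 3 1 * y + S 3 2 * z) * (x * x - z * z) +
      (S 4 0 * x + S 4 1 * y + S 4 2 * z) * (y * y - z * z) = 0 := by
    intro x y z
    have := congrArg (eval (n.mulVec ![x, y, z])) hS
    simpa [Fin.sum_univ_five, Fin.sum_univ_three, quadrics, eval_mulVec_linForm h] using this
  -- Values at (1, 1, 0) and (1, -1, 0) give the sum and difference of the coefficients of x²y and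
  -- xy²; separating them requires 2 ≠ 0. The same holds for the other two pairs of variables.
  have half : ∀ a b : k, a + b = 0 → b - a = 0 → a = 0 ∧ b = 0 := by
    intro a b h h'
    have : (2 : k) * b = 0 := by linear_combination h + h'
    have hb := (mul_eq_zero.mp this).resolve_left h2
    exact ⟨by linear_combination h - hb, hb⟩
  have e30 : S 3 0 = 0 := by linear_combination key 1 0 0
  have e41 : S 4 1 = 0 := by linear_combination key 0 1 0
  have e42 : S 4 2 = -S 3 2 := by linear_combination -key 0 0 1
  obtain ⟨exy, exy'⟩ := half (S 0 0 + S 3 1) (S 0 1 + S 4 0)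
    (by linear_combination key 1 1 0 - e30 - e41)
    (by linear_combination key 1 (-1) 0 - e30 + e41)
  obtain ⟨exz, exz'⟩ := half (S 1 0 + S 3 2) (S 1 2 - S 3 0 - S 4 0)
    (by linear_combination key 1 0 1 - e30 + e42)
    (by linear_combination key 1 0 (-1) - e30 - e42)
  obtain ⟨eyz, eyz'⟩ := half (S 2 1 + S 4 2) (S 2 2 - S 3 1 - S 4 1)
    (by linear_combination key 0 1 1 - e41 + e42)
    (by linear_combination key 0 1 (-1) - e41 - e42)
  refine ⟨e30, e41, e42, ?_, ?_, ?_, ?_, ?_, ?_, ?_⟩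
  · linear_combination exy
  · linear_combination exz
  · linear_combination exy'
  · linear_combination eyz - e42
  · linear_combination exz' + e30
  · linear_combination eyz' + e41
  · linear_combination key 1 1 1 - exy - exy' - exz - exz' - eyz - eyz' + e42 - e30 - e41

lemma isHomogeneous_pfaffians {n : ℕ} {φ : Matrix (Fin 5) (Fin 5) (MvPolynomial (Fin n) k)}
    (hφ : ∀ i j, (φ i j).IsHomogeneous 1) (i : Fin 5) : (pfaffians φ i).IsHomogeneous 2 := by
  have h : ∀ a b c d, (φ a b * φ c d).IsHomogeneous 2 := fun a b c d => (hφ a b).mul (hφ c d)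
  have h' := ((h (i.succAbove 0) (i.succAbove 1) (i.succAbove 2) (i.succAbove 3)).sub
    (h (i.succAbove 0) (i.succAbove 2) (i.succAbove 1) (i.succAbove 3))).add
    (h (i.succAbove 0) (i.succAbove 3) (i.succAbove 1) (i.succAbove 2))
  have hs : ((-1 : MvPolynomial (Fin n) k) ^ (i : ℕ)).IsHomogeneous 0 := by
    simpa using ((isHomogeneous_one (Fin n) k).neg).pow (i : ℕ)
  have := hs.mul h'
  rwa [zero_add] at this

/-- If the Pfaffians of `φ` generate the ideal of the five quadrics, then the quadrics
and the Pfaffians are combinations of each other by inverse matrices over the field. -/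
lemma exists_pfaffians_matrix (h : m * n = 1)
    {φ : Matrix (Fin 5) (Fin 5) (MvPolynomial (Fin 3) k)}
    (hφ : IsPfaffianMatrix φ (Ideal.span (Set.range (quadrics (linForm m))))) :
    ∃ P Q : Matrix (Fin 5) (Fin 5) k, P * Q = 1 ∧
      (∀ l, quadrics (linForm m) l = ∑ j, C (P l j) * pfaffians φ j) ∧
      ∀ j, pfaffians φ j = ∑ l, C (Q j l) * quadrics (linForm m) l := by
  have hp := isHomogeneous_pfaffians hφ.linear
  choose P hP using fun l => exists_coeff_of_mem_span hp (isHomogeneous_quadrics m l)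
    (hφ.span_eq ▸ Ideal.subset_span ⟨l, rfl⟩)
  choose Q hQ using fun j => exists_coeff_of_mem_span (isHomogeneous_quadrics m) (hp j)
    (hφ.span_eq ▸ Ideal.subset_span ⟨j, rfl⟩)
  refine ⟨Matrix.of P, Matrix.of Q, ?_, hP, hQ⟩
  ext l l'
  -- The quadrics equal P Q times themselves, so their independence gives P Q = 1.
  have key : ∑ i, C ((Matrix.of P * Matrix.of Q) l i - (1 : Matrix _ _ k) l i) *
      quadrics (linForm m) i + C 0 * (linForm m 2 * linForm m 2) = 0 := by
    have h1 : ∑ i, C ((1 : Matrix (Fin 5) (Fin 5) k) l i) * quadrics (linForm m) i =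
        quadrics (linForm m) l := by
      rw [Finset.sum_eq_single l (fun j _ hj => by simp [Matrix.one_apply_ne hj.symm]) (by simp)]
      simp
    have h2 : ∑ i, C ((Matrix.of P * Matrix.of Q) l i) * quadrics (linForm m) i =
        quadrics (linForm m) l := by
      conv_rhs => rw [hP l]
      simp only [hQ, Matrix.mul_apply, Matrix.of_apply, map_sum, Finset.sum_mul, Finset.mul_sum,
        map_mul]
      rw [Finset.sum_comm]
      exact Finset.sum_congr rfl fun j _ => Finset.sum_congr rfl fun i _ => mul_assoc _ _ _
    simp only [map_sub, sub_mul, Finset.sum_sub_distrib, h1, h2, map_zero, zero_mul, add_zero,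
      sub_self]
  exact sub_eq_zero.mp (congrFun (quadrics_independent h _ _ key).1 l')

end Quadrics

/-! ### Arbitrary Pfaffian matrices of the five quadrics -/

section Main

variable {k : Type*} [Field k] {m n : Matrix (Fin 3) (Fin 3) k}

lemma diag_eq_zero_of_skew {A : Type*} [CommRing A] [IsDomain A] (h2 : (2 : A) ≠ 0) {s : ℕ}
    {φ : Matrix (Fin s) (Fin s) A} (h : φ.transpose = -φ) (i : Fin s) : φ i i = 0 := by
  have h' : φ i i = -φ i i := congrFun (congrFun h i) i
  have : (2 : A) * φ i i = 0 := by linear_combination h'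
  exact (mul_eq_zero.mp this).resolve_left h2

lemma two_ne_zero_mvPolynomial {σ : Type*} (h2 : (2 : k) ≠ 0) : (2 : MvPolynomial σ k) ≠ 0 := by
  intro h
  refine h2 ((C_eq_zero (σ := σ)).mp ?_)
  rw [map_ofNat, h]

/-- The columns of a Pfaffian matrix for the five quadrics are independent over the field. -/
lemma eq_zero_of_sum_column_eq_zero (h2 : (2 : k) ≠ 0) (h : m * n = 1)
    {φ : Matrix (Fin 5) (Fin 5) (MvPolynomial (Fin 3) k)}
    (hφ : IsPfaffianMatrix φ (Ideal.span (Set.range (quadrics (linForm m)))))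
    (v : Fin 5 → k) (hv : ∀ i, ∑ j, φ i j * C (v j) = 0) : v = 0 := by
  obtain ⟨P, Q, hPQ, hP, hQ⟩ := exists_pfaffians_matrix h hφ
  have hcomm := pfaffians_mul_comm_of_mulVec_eq_zero hφ.skew
    (diag_eq_zero_of_skew (two_ne_zero_mvPolynomial h2) hφ.skew) (fun j => C (v j)) hv
  by_contra hne
  obtain ⟨j, hj⟩ := Function.ne_iff.mp hne
  -- all Pfaffians are multiples of the `j`-th one, and so are the five quadrics
  have hq : ∀ l, ∃ c : k, quadrics (linForm m) l = C c * pfaffians φ j := by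
    intro l
    refine ⟨∑ i, P l i * (v i * (v j)⁻¹), ?_⟩
    rw [hP l, map_sum, Finset.sum_mul]
    refine Finset.sum_congr rfl fun i _ => ?_
    have h1 : pfaffians φ i * C (v j) * C ((v j)⁻¹) = pfaffians φ i := by
      rw [mul_assoc, ← C_mul, mul_inv_cancel₀ hj, C_1, mul_one]
    rw [← h1, hcomm i j, map_mul, map_mul]
    ring
  obtain ⟨c, hc⟩ := hq 0
  obtain ⟨c', hc'⟩ := hq 1
  -- If xy = c f and xz = c' f, then c' · xy - c · xz = 0, against independence.
  have hsum : ∑ i, C ((![c', -c, 0, 0, 0] : Fin 5 → k) i) * quadrics (linForm m) i +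
      C 0 * (linForm m 2 * linForm m 2) = 0 := by
    simp only [Fin.sum_univ_five]
    rw [hc, hc']
    simp
    ring
  have h0 := (quadrics_independent h _ _ hsum).1
  have hcz : c = 0 := by simpa using congrFun h0 1
  have hc0 : quadrics (linForm m) 0 = 0 := by rw [hc, hcz, map_zero, zero_mul]
  have := quadrics_independent h ![1, 0, 0, 0, 0] 0 (by simp [Fin.sum_univ_five, hc0])
  simpa using congrFun this.1 0

/-- The linear forms `P · T`. -/
def coordT (P : Matrix (Fin 5) (Fin 5) k) (l : Fin 5) :
    MvPolynomial (Fin 5) (MvPolynomial (Fin 3) k) :=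
  ∑ j, C (C (P l j)) * X j

/-- The generators of `R[T]` over `k` that correspond to the generators of the Rees algebra. -/
def coordGens (m : Matrix (Fin 3) (Fin 3) k) (P : Matrix (Fin 5) (Fin 5) k) :
    Fin 8 → MvPolynomial (Fin 5) (MvPolynomial (Fin 3) k) :=
  ![C (linForm m 0), C (linForm m 1), C (linForm m 2), coordT P 0, coordT P 1, coordT P 2,
    coordT P 3, coordT P 4]

lemma sum_mul_coordT {P Q : Matrix (Fin 5) (Fin 5) k} (hQP : Q * P = 1) (i : Fin 5) :
    ∑ l, C (C (Q i l)) * coordT P l = X i := by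
  simp only [coordT, Finset.mul_sum]
  rw [Finset.sum_comm]
  have : ∀ j, ∑ l, C (C (Q i l)) * (C (C (P l j)) * X j) =
      C (C ((Q * P) i j)) * (X j : MvPolynomial (Fin 5) (MvPolynomial (Fin 3) k)) := by
    intro j
    simp only [Matrix.mul_apply, map_sum, Finset.sum_mul, map_mul, mul_assoc]
  simp only [this, hQP]
  rw [Finset.sum_eq_single i (fun j _ hj => by simp [Matrix.one_apply_ne hj.symm]) (by simp)]
  simp

lemma coordGens_surjective (h : m * n = 1) {P Q : Matrix (Fin 5) (Fin 5) k} (hQP : Q * P = 1) :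
    Function.Surjective (aeval (coordGens m P) : MvPolynomial (Fin 8) k →ₐ[k] _) := by
  set S := (aeval (coordGens m P) : MvPolynomial (Fin 8) k →ₐ[k] _).range with hS
  have hgen : ∀ i, coordGens m P i ∈ S := fun i => ⟨X i, aeval_X _ _⟩
  have hx : ∀ r, C (linForm m r) ∈ S := by
    intro r
    fin_cases r
    exacts [hgen 0, hgen 1, hgen 2]
  have hT : ∀ l, coordT P l ∈ S := by
    intro l
    fin_cases l
    exacts [hgen 3, hgen 4, hgen 5, hgen 6, hgen 7]
  have hk : ∀ a : k, C (C a) ∈ S := fun a => S.algebraMap_mem a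
  have hC : ∀ p, C p ∈ S := by
    intro p
    obtain ⟨p, rfl⟩ := aeval_linForm_surjective h p
    induction p using MvPolynomial.induction_on with
    | C a => rw [algHom_C]; exact hk a
    | add p q hp hq => rw [map_add, map_add]; exact add_mem hp hq
    | mul_X p i hp => rw [map_mul, map_mul, aeval_X]; exact mul_mem hp (hx i)
  intro g
  change g ∈ S
  induction g using MvPolynomial.induction_on with
  | C a => exact hC a
  | add p q hp hq => exact add_mem hp hq
  | mul_X p i hp =>
    refine mul_mem hp ?_
    rw [← sum_mul_coordT hQP i]
    exact sum_mem fun l _ => mul_mem (hk _) (hT l)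

/-- The inclusion of the constants into `R[T]`. -/
abbrev constHom (k : Type*) [Field k] : k →+* MvPolynomial (Fin 5) (MvPolynomial (Fin 3) k) :=
  (C : MvPolynomial (Fin 3) k →+* _).comp C

/-- In the coordinates given by the five quadrics, the coefficient matrix of the linear relations
is equivalent to the Jacobian dual. -/
lemma exists_linCoeff_eq (h2 : (2 : k) ≠ 0) (h : m * n = 1)
    {φ : Matrix (Fin 5) (Fin 5) (MvPolynomial (Fin 3) k)}
    (hφ : IsPfaffianMatrix φ (Ideal.span (Set.range (quadrics (linForm m)))))
    {P Q : Matrix (Fin 5) (Fin 5) k} (hQP : Q * P = 1)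
    (hQ : ∀ j, pfaffians φ j = ∑ l, C (Q j l) * quadrics (linForm m) l) :
    ∃ N : Matrix (Fin 5) (Fin 5) k,
      linCoeff (coordGens m P) = N.map (constHom k) * jacobianDual φ * n.map (constHom k) := by
  choose c hc using fun i j => exists_linForm_coeff h (hφ.linear i j)
  have hsyz := sum_pfaffians_mul hφ.skew
    (diag_eq_zero_of_skew (two_ne_zero_mvPolynomial h2) hφ.skew)
  -- With the Pfaffians written as Q times the quadrics, the j-th column of φ becomes a linear
  -- syzygy of the quadrics with coefficients `S j`.
  let S : Fin 5 → Fin 5 → Fin 3 → k := fun j l r => ∑ i, Q i l * c i j r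
  have hS : ∀ j, ∑ l, (∑ r, C (S j l r) * linForm m r) * quadrics (linForm m) l = 0 := by
    intro j
    have hs : ∀ l, ∑ r, C (S j l r) * linForm m r = ∑ i, C (Q i l) * φ i j := by
      intro l
      simp only [hc _ j, S, map_sum, map_mul, Finset.sum_mul, Finset.mul_sum]
      rw [Finset.sum_comm]
      exact Finset.sum_congr rfl fun i _ => Finset.sum_congr rfl fun r _ => mul_assoc _ _ _
    rw [← hsyz j]
    simp only [hs, hQ, Finset.sum_mul]
    rw [Finset.sum_comm]
    exact Finset.sum_congr rfl fun i _ => Finset.sum_congr rfl fun r _ => by ring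
  -- By `syzygy_coeff` a syzygy has five free coefficients; `N j` consists of its coordinates with
  -- respect to the rows of `linCoeff`.
  let N : Matrix (Fin 5) (Fin 5) k := Matrix.of fun j =>
    ![S j 2 0 + S j 1 1, -S j 1 1, -S j 4 0, -S j 3 1, -S j 3 2]
  let G : Matrix (Fin 5) (Fin 3) (MvPolynomial (Fin 5) (MvPolynomial (Fin 3) k)) :=
    Matrix.of fun j r => ∑ i, C (C (c i j r)) * X i
  have hG : G = N.map (constHom k) * linCoeff (coordGens m P) := by
    ext1 j r
    have e : G j r = ∑ l, C (C (S j l r)) * coordT P l := by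
      simp only [G, Matrix.of_apply, S, map_sum, map_mul, Finset.sum_mul]
      rw [Finset.sum_comm]
      refine Finset.sum_congr rfl fun i _ => ?_
      rw [← sum_mul_coordT hQP i, Finset.mul_sum]
      exact Finset.sum_congr rfl fun l _ => by ring
    obtain ⟨e1, e2, e3, e4, e5, e6, e7, e8, e9, e10⟩ := syzygy_coeff h2 h (S j) (hS j)
    rw [e, Matrix.mul_apply, Fin.sum_univ_five, Fin.sum_univ_five]
    have hNj : N j = ![S j 2 0 + S j 1 1, -S j 1 1, -S j 4 0, -S j 3 1, -S j 3 2] := rfl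
    simp only [Matrix.map_apply, hNj]
    clear_value S
    fin_cases r <;>
      simp [linCoeff, coordGens, e1, e2, e3, e4, e5, e6, e7, e8, e9, e10] <;> ring
  have hGJ : jacobianDual φ = G * m.map (constHom k) := by
    ext1 j l
    rw [jacobianDual, Matrix.of_apply, xDeriv_TMul, Matrix.mul_apply]
    simp only [hc _ j, map_sum, pderiv_C_mul, pderiv_linForm, G, Matrix.of_apply, Finset.sum_mul,
      Finset.mul_sum]
    rw [Finset.sum_comm]
    refine Finset.sum_congr rfl fun i _ => Finset.sum_congr rfl fun r _ => ?_
    simp only [map_mul, Matrix.map_apply, RingHom.comp_apply]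
    ring
  -- A vector in the left kernel of N would be a constant relation between the columns of φ.
  have hN : N.det ≠ 0 := by
    intro hdet
    obtain ⟨v, hv0, hv⟩ := Matrix.exists_vecMul_eq_zero_iff.mpr hdet
    refine hv0 (eq_zero_of_sum_column_eq_zero h2 h hφ v fun i => ?_)
    have hvG : ∀ r, ∑ j, constHom k (v j) * G j r = 0 := by
      intro r
      have : ∀ l, ∑ j, constHom k (v j) * constHom k (N j l) = 0 := by
        intro l
        simp only [← map_mul, ← map_sum]
        rw [show ∑ j, v j * N j l = 0 from congrFun hv l, map_zero]
      simp only [hG, Matrix.mul_apply, Finset.mul_sum, Matrix.map_apply]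
      rw [Finset.sum_comm]
      refine Finset.sum_eq_zero fun l _ => ?_
      simp only [← mul_assoc]
      rw [← Finset.sum_mul, this, zero_mul]
    have hvc : ∀ r, ∑ j, C (v j) * C (c i j r) = (0 : MvPolynomial (Fin 3) k) := by
      intro r
      have := congrArg (eval (Pi.single i (1 : MvPolynomial (Fin 3) k))) (hvG r)
      simpa [G, Pi.single_apply] using this
    simp only [hc i, Finset.sum_mul]
    rw [Finset.sum_comm]
    refine Finset.sum_eq_zero fun r _ => ?_
    have : ∀ j, C (c i j r) * linForm m r * C (v j) = C (v j) * C (c i j r) * linForm m r :=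
      fun j => by ring
    simp only [this]
    rw [← Finset.sum_mul, hvc, zero_mul]
  refine ⟨N⁻¹, ?_⟩
  have hNN : N⁻¹ * N = 1 := Matrix.nonsing_inv_mul _ (isUnit_iff_ne_zero.mpr hN)
  have e1 : (N⁻¹).map (constHom k) * N.map (constHom k) = 1 := by
    rw [← Matrix.map_mul, hNN, Matrix.map_one _ (map_zero _) (map_one _)]
  have e2 : m.map (constHom k) * n.map (constHom k) = 1 := by
    rw [← Matrix.map_mul, h, Matrix.map_one _ (map_zero _) (map_one _)]
  rw [hGJ, hG, Matrix.mul_assoc, Matrix.mul_assoc, Matrix.mul_assoc, e2, Matrix.mul_one,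
    ← Matrix.mul_assoc, e1, Matrix.one_mul]

/-- Since n m = 1, the coefficient matrix N ψ n applied to the forms m x is N (ψ x), and ψ x is T ·
φ. -/
lemma linRel_coordGens_mem (h : m * n = 1)
    {φ : Matrix (Fin 5) (Fin 5) (MvPolynomial (Fin 3) k)} (hφ : ∀ i j, (φ i j).IsHomogeneous 1)
    {P N : Matrix (Fin 5) (Fin 5) k}
    (hN : linCoeff (coordGens m P) = N.map (constHom k) * jacobianDual φ * n.map (constHom k))
    (i : Fin 5) : linRel (coordGens m P) i ∈ dualIdeal φ := by
  have e : linRel (coordGens m P) i =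
      (linCoeff (coordGens m P)).mulVec (fun r => C (linForm m r)) i := by
    rw [Matrix.mulVec, dotProduct, Fin.sum_univ_three]
    rfl
  have hx : (n.map (constHom k)).mulVec (fun r => C (linForm m r)) = fun l => C (X l) := by
    funext l
    rw [← sum_mul_linForm (mul_eq_one_comm.mp h) l]
    simp [Matrix.mulVec, dotProduct]
  have hT : (jacobianDual φ).mulVec (fun l => C (X l)) = TMul φ :=
    funext fun j => sum_jacobianDual_mul hφ j
  rw [e, hN, ← Matrix.mulVec_mulVec, hx, ← Matrix.mulVec_mulVec, hT]
  have hj : ∀ j, TMul φ j ∈ dualIdeal φ := fun j =>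
    Ideal.mem_sup_left (Ideal.subset_span ⟨j, rfl⟩)
  rw [Matrix.mulVec, dotProduct]
  exact Ideal.sum_mem _ fun j _ => Ideal.mul_mem_left _ _ (hj j)

lemma det_linCoeff_coordGens_mem {φ : Matrix (Fin 5) (Fin 5) (MvPolynomial (Fin 3) k)}
    {P N : Matrix (Fin 5) (Fin 5) k}
    (hN : linCoeff (coordGens m P) = N.map (constHom k) * jacobianDual φ * n.map (constHom k))
    (a b c : Fin 5) :
    ((linCoeff (coordGens m P)).submatrix ![a, b, c] id).det ∈ dualIdeal φ := by
  have hle : minorsIdeal 3 (linCoeff (coordGens m P)) ≤ dualIdeal φ := by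
    rw [hN]
    exact ((minorsIdeal_mul_right_le _ _ _).trans
      (minorsIdeal_mul_left_le _ _ _)).trans le_sup_right
  exact hle (Ideal.subset_span ⟨_, _, rfl⟩)

/-- Followed by T_i ↦ f_i t, the map `coordGens` is `reesGens` after the linear substitution
`linForm m`, which is injective. -/
lemma aeval_reesGens_eq_zero (h : m * n = 1) {f : Fin 5 → MvPolynomial (Fin 3) k}
    {P : Matrix (Fin 5) (Fin 5) k} (hP : ∀ l, quadrics (linForm m) l = ∑ j, C (P l j) * f j)
    {g : MvPolynomial (Fin 8) k} (hg : aeval (coordGens m P) g ∈ reesIdeal f) :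
    aeval (reesGens k) g = 0 := by
  let π : MvPolynomial (Fin 5) (MvPolynomial (Fin 3) k) →ₐ[MvPolynomial (Fin 3) k]
    Polynomial (MvPolynomial (Fin 3) k) := aeval fun i => Polynomial.monomial 1 (f i)
  have hπC : ∀ p, π (C p) = Polynomial.C p := fun p => algHom_C π p
  have hπT : ∀ l, π (coordT P l) = Polynomial.monomial 1 (quadrics (linForm m) l) := by
    intro l
    simp only [coordT, map_sum, map_mul, hπC, hP l]
    exact Finset.sum_congr rfl fun j _ => by simp [π, Polynomial.C_mul_monomial]
  have hπ : π (aeval (coordGens m P) g) = 0 := hg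
  clear_value π
  have hcomp : (π.restrictScalars k).comp (aeval (coordGens m P)) =
      (Polynomial.mapAlgHom (aeval (linForm m))).comp (aeval (reesGens k)) := by
    ext1 i
    simp only [AlgHom.comp_apply, aeval_X, AlgHom.restrictScalars_apply]
    fin_cases i <;>
      simp [coordGens, reesGens, hπC, hπT, quadrics, Polynomial.map_monomial]
  have h3 := DFunLike.congr_fun hcomp g
  simp only [AlgHom.comp_apply, AlgHom.restrictScalars_apply, hπ] at h3
  exact Polynomial.map_injective _ (aeval_linForm_injective h)
    (h3.symm.trans (Polynomial.map_zero _).symm)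

lemma aeval_mem_of_linRel_mem {A : Type*} [CommRing A] [Algebra k A] (D : Ideal A)
    {v : Fin 8 → A} (hl : ∀ i, linRel v i ∈ D)
    (hm : ∀ a b c : Fin 5, ((linCoeff v).submatrix ![a, b, c] id).det ∈ D)
    {g : MvPolynomial (Fin 8) k} (hg : aeval (reesGens k) g = 0) : aeval v g ∈ D := by
  have hv : aeval (Ideal.Quotient.mk D ∘ v) g = Ideal.Quotient.mk D (aeval v g) := by
    have : (aeval (Ideal.Quotient.mk D ∘ v) : MvPolynomial (Fin 8) k →ₐ[k] _) =
        (Ideal.Quotient.mkₐ k D).comp (aeval v) := by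
      ext1 i; simp
    rw [this]; rfl
  rw [← Ideal.Quotient.eq_zero_iff_mem, ← hv]
  refine aeval_eq_zero_of_linRel (fun i => ?_) (fun a b c => ?_) hg
  · rw [← map_linRel, Ideal.Quotient.eq_zero_iff_mem]; exact hl i
  · have e : linCoeff (Ideal.Quotient.mk D ∘ v) = (linCoeff v).map (Ideal.Quotient.mk D) := by
      ext i j
      fin_cases i <;> fin_cases j <;> simp [linCoeff]
    rw [e, Matrix.submatrix_map]
    exact (RingHom.map_det (Ideal.Quotient.mk D) _).symm.trans
      (Ideal.Quotient.eq_zero_iff_mem.mpr (hm a b c))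

/-- The relations of the Rees algebra are those given by the Jacobian dual. -/
theorem dualIdeal_eq_reesIdeal (h2 : (2 : k) ≠ 0) (h : m * n = 1)
    {φ : Matrix (Fin 5) (Fin 5) (MvPolynomial (Fin 3) k)}
    (hφ : IsPfaffianMatrix φ (Ideal.span (Set.range (quadrics (linForm m))))) :
    dualIdeal φ = reesIdeal (pfaffians φ) := by
  refine le_antisymm (dualIdeal_le_reesIdeal hφ.linear (sum_pfaffians_mul hφ.skew
    (diag_eq_zero_of_skew (two_ne_zero_mvPolynomial h2) hφ.skew))) fun g hg => ?_
  obtain ⟨P, Q, hPQ, hP, hQ⟩ := exists_pfaffians_matrix h hφ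
  have hQP := mul_eq_one_comm.mp hPQ
  obtain ⟨N, hN⟩ := exists_linCoeff_eq h2 h hφ hQP hQ
  obtain ⟨g, rfl⟩ := coordGens_surjective h hQP g
  exact aeval_mem_of_linRel_mem _ (linRel_coordGens_mem h hφ.linear hN)
    (det_linCoeff_coordGens_mem hN) (aeval_reesGens_eq_zero h hP hg)

end Main

/-! ### A Pfaffian matrix for the five quadrics -/

section Existence

variable {k : Type*} [Field k]

/-- A skew-symmetric matrix of linear forms with Pfaffians the five quadrics. -/
def quadricsMatrix {A : Type*} [CommRing A] (x : Fin 3 → A) : Matrix (Fin 5) (Fin 5) A :=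
  !![0, x 0, -x 1, -x 2, x 2;
     -x 0, 0, x 2, x 1, 0;
     x 1, -x 2, 0, 0, -x 0;
     x 2, -x 1, 0, 0, 0;
     -x 2, 0, x 0, 0, 0]

lemma pfaffians_quadricsMatrix {A : Type*} [CommRing A] (x : Fin 3 → A) :
    pfaffians (quadricsMatrix x) = quadrics x := by
  rw [pfaffians_eq]
  funext i
  fin_cases i <;> simp [quadricsMatrix, quadrics] <;> ring

lemma isPfaffianMatrix_quadricsMatrix (m : Matrix (Fin 3) (Fin 3) k) :
    IsPfaffianMatrix (quadricsMatrix (linForm m))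
      (Ideal.span (Set.range (quadrics (linForm m)))) where
  skew := by
    ext1 i j
    fin_cases i <;> fin_cases j <;> simp [quadricsMatrix]
  linear i j := by
    have h := isHomogeneous_linForm m
    have h0 := isHomogeneous_zero (R := k) (Fin 3) 1
    fin_cases i <;> fin_cases j <;> simp [quadricsMatrix] <;>
      first | exact h0 | exact h _ | exact (h _).neg
  span_eq := by rw [pfaffians_quadricsMatrix]

end Existence

/-! ### Depth one from an element multiplied into the Rees algebra -/

section Depth

variable {k : Type*} [Field k] {n : ℕ}

/-- If the variables multiply `w` into `I`, and `I` multiplies `w` into `I ^ 2`, then the maximal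
homogeneous ideal multiplies `w t` into the Rees algebra. -/
lemma exists_mul_monomial {I : Ideal (MvPolynomial (Fin n) k)} {w : MvPolynomial (Fin n) k}
    (hX : ∀ l, X l * w ∈ I) (hI : ∀ f ∈ I, f * w ∈ I ^ 2) {a : reesAlgebra I}
    (ha : a ∈ reesMaximalIdeal I) :
    ∃ b : reesAlgebra I, (b : Polynomial (MvPolynomial (Fin n) k)) =
      a * Polynomial.monomial 1 w := by
  have ha0 : constantCoeff ((a : Polynomial (MvPolynomial (Fin n) k)).coeff 0) = 0 := ha
  have hconst : ∀ p : MvPolynomial (Fin n) k, p * w - C (constantCoeff p) * w ∈ I := by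
    intro p
    induction p using MvPolynomial.induction_on with
    | C a => simp
    | add p q hp hq =>
      convert add_mem hp hq using 1
      simp only [map_add]; ring
    | mul_X p i _ =>
      have := Ideal.mul_mem_left I p (hX i)
      convert this using 1
      simp [mul_assoc]
  refine ⟨⟨a * Polynomial.monomial 1 w, fun i => ?_⟩, rfl⟩
  -- The product has no component of degree 0 in t. In degree 1 it is a₀ w, where a₀ has no constant
  -- term; in degree i + 2 it is a_{i+1} w with a_{i+1} in I^(i+1).
  rcases i with _ | _ | i
  · simp
  · rw [Polynomial.coeff_mul_monomial]
    have := hconst ((a : Polynomial (MvPolynomial (Fin n) k)).coeff 0)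
    simpa [ha0] using this
  · rw [Polynomial.coeff_mul_monomial]
    have h1 : I ^ (i + 1) ≤ Submodule.comap (LinearMap.mulRight _ w) (I ^ (i + 2)) := by
      rw [pow_succ, show i + 2 = i + 1 + 1 from rfl]
      refine Ideal.mul_le.mpr fun r hr s hs => ?_
      have := Ideal.mul_mem_mul hr (hI s hs)
      rw [← pow_add] at this
      simpa [mul_assoc] using this
    simpa using h1 (a.2 (i + 1))

/-- If moreover `w` is not in `I`, the Rees algebra has depth one. -/
lemma depthAlong_reesMaximalIdeal_eq_one [NeZero n] {I : Ideal (MvPolynomial (Fin n) k)}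
    {w : MvPolynomial (Fin n) k} (hw : w ∉ I) (hX : ∀ l, X l * w ∈ I)
    (hI : ∀ f ∈ I, f * w ∈ I ^ 2) : depthAlong (reesMaximalIdeal I) = 1 := by
  have hne : reesMaximalIdeal I ≠ ⊤ := RingHom.ker_ne_top _
  apply le_antisymm
  · refine iSup_le fun rs => iSup_le fun hreg => iSup_le fun hmem => ?_
    match rs, hreg, hmem with
    | [], _, _ => simp
    | [a], _, _ => simp
    | a :: b :: rs, hreg, hmem =>
      exfalso
      have hw1 := (RingTheory.Sequence.isWeaklyRegular_cons_iff _ _ _).mp hreg.toIsWeaklyRegular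
      have hw2 := (RingTheory.Sequence.isWeaklyRegular_cons_iff _ _ _).mp hw1.2
      obtain ⟨a', ha'⟩ := exists_mul_monomial hX hI (hmem a (by simp))
      obtain ⟨b', hb'⟩ := exists_mul_monomial hX hI (hmem b (by simp))
      -- With a' = a · wt and b' = b · wt, b kills the class of a' modulo a. Regularity gives a' = a
      -- d, so cancelling a yields wt = d in the Rees algebra, against w ∉ I.
      have hab : b * a' = a * b' := by
        apply Subtype.ext
        simp only [MulMemClass.coe_mul, ha', hb']
        ring
      have hz : b • (Submodule.Quotient.mk a' : QuotSMulTop a (reesAlgebra I)) = 0 := by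
        rw [← Submodule.Quotient.mk_smul, Submodule.Quotient.mk_eq_zero, smul_eq_mul, hab]
        exact Submodule.smul_mem_pointwise_smul _ _ _ trivial
      have hz' := hw2.1.right_eq_zero_of_smul hz
      rw [Submodule.Quotient.mk_eq_zero] at hz'
      obtain ⟨d, -, hd⟩ := hz'
      have ha0 : (a : Polynomial (MvPolynomial (Fin n) k)) ≠ 0 := by
        intro h0
        have : a = 0 := Subtype.ext h0
        have h1 := hw1.1 (show a • (1 : reesAlgebra I) = a • 0 by simp [this])
        exact one_ne_zero h1
      have hd' : (d : Polynomial (MvPolynomial (Fin n) k)) = Polynomial.monomial 1 w := by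
        apply mul_left_cancel₀ ha0
        rw [← ha', ← hd]
        rfl
      have := d.2 1
      rw [hd'] at this
      exact hw (by simpa using this)
  -- A variable alone is a regular sequence: it is nonzero in a domain and lies in a proper ideal.
  · have hx : algebraMap _ (reesAlgebra I) (X 0 : MvPolynomial (Fin n) k) ∈ reesMaximalIdeal I := by
      change constantCoeff ((Polynomial.C (X 0 : MvPolynomial (Fin n) k)).coeff 0) = 0
      simp
    have hreg : RingTheory.Sequence.IsRegular (reesAlgebra I)
        [algebraMap _ (reesAlgebra I) (X 0 : MvPolynomial (Fin n) k)] := by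
      refine ⟨?_, ?_⟩
      · rw [RingTheory.Sequence.isWeaklyRegular_cons_iff]
        refine ⟨?_, RingTheory.Sequence.IsWeaklyRegular.nil _ _⟩
        intro u v huv
        apply Subtype.ext
        have h := congrArg (Subtype.val) huv
        exact mul_left_cancel₀ (a := Polynomial.C (X 0 : MvPolynomial (Fin n) k))
          (by simp) h
      · intro htop
        apply hne
        rw [eq_top_iff, htop]
        refine Submodule.smul_le.mpr fun r hr s _ => ?_
        refine Ideal.mul_mem_right _ _ ?_
        have : Ideal.ofList [algebraMap _ (reesAlgebra I) (X 0 : MvPolynomial (Fin n) k)] ≤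
            reesMaximalIdeal I := by
          refine Ideal.span_le.mpr ?_
          intro y hy
          simp at hy
          rw [hy]; exact hx
        exact this hr
    refine le_trans ?_ (le_iSup_of_le [algebraMap _ (reesAlgebra I) (X 0)]
      (le_iSup_of_le hreg (le_iSup_of_le (by simpa using hx) le_rfl)))
    simp

end Depth

/-! ### The Jacobian ideal of the four points -/

section Jacobian

variable {k : Type*} [Field k] {n a b : ℕ}

/-- If g = H g', then by the Leibniz rule the Jacobian matrix of g is H times that of g' modulo
(g'), so its 2-minors vanish wherever those of g' do. -/
lemma jacobianIdeal_two_le {g : Fin a → MvPolynomial (Fin n) k} {g' : Fin b → MvPolynomial (Fin n) k}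
    (h : Ideal.span (Set.range g) ≤ Ideal.span (Set.range g')) :
    jacobianIdeal 2 g ≤ jacobianIdeal 2 g' := by
  refine sup_le (h.trans le_sup_left) (Ideal.span_le.mpr ?_)
  rintro _ ⟨r, c, rfl⟩
  choose H hH using fun i =>
    Ideal.mem_span_range_iff_exists_fun.mp (h (Ideal.subset_span ⟨i, rfl⟩))
  let q := Ideal.Quotient.mk (jacobianIdeal 2 g')
  have hq : ∀ x, x ∈ jacobianIdeal 2 g' → q x = 0 := fun x hx =>
    Ideal.Quotient.eq_zero_iff_mem.mpr hx
  have hg' : ∀ j, q (g' j) = 0 := fun j =>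
    hq _ (Ideal.mem_sup_left (Ideal.subset_span ⟨j, rfl⟩))
  have hminor : ∀ j j' l l', q (pderiv l (g' j)) * q (pderiv l' (g' j')) =
      q (pderiv l' (g' j)) * q (pderiv l (g' j')) := by
    intro j j' l l'
    have := hq _ (Ideal.mem_sup_right (Ideal.subset_span ⟨![j, j'], ![l, l'], rfl⟩))
    rw [Matrix.det_fin_two] at this
    simpa [jacobianMatrix, sub_eq_zero] using this
  have hder : ∀ i l, q (pderiv l (g i)) = ∑ j, q (H i j) * q (pderiv l (g' j)) := by
    intro i l
    rw [← hH i, map_sum, map_sum]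
    refine Finset.sum_congr rfl fun j _ => ?_
    rw [Derivation.leibniz, map_add, smul_eq_mul, smul_eq_mul, map_mul, map_mul, hg', zero_mul,
      add_zero]
  rw [SetLike.mem_coe, ← Ideal.Quotient.eq_zero_iff_mem, Matrix.det_fin_two]
  change q _ = 0
  simp only [jacobianMatrix, Matrix.submatrix_apply, Matrix.of_apply, map_sub, map_mul, hder,
    Finset.sum_mul_sum]
  rw [sub_eq_zero]
  refine Finset.sum_congr rfl fun j _ => Finset.sum_congr rfl fun j' _ => ?_
  linear_combination q (H (r 0) j) * q (H (r 1) j') * hminor j j' (c 0) (c 1)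

/-- The Jacobian ideal depends only on the ideal. -/
lemma jacobianIdeal_two_congr {g : Fin a → MvPolynomial (Fin n) k}
    {g' : Fin b → MvPolynomial (Fin n) k}
    (h : Ideal.span (Set.range g) = Ideal.span (Set.range g')) :
    jacobianIdeal 2 g = jacobianIdeal 2 g' :=
  le_antisymm (jacobianIdeal_two_le h.le) (jacobianIdeal_two_le h.ge)

/-- The pencil of conics through the points `(±1, ±1, 1)`. -/
def conics {A : Type*} [CommRing A] (x : Fin 3 → A) : Fin 2 → A :=
  ![x 0 * x 0 - x 2 * x 2, x 1 * x 1 - x 2 * x 2]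

/-- The Jacobian ideal of the four points is generated by the five quadrics. -/
lemma jacobianIdeal_conics (h2 : (2 : k) ≠ 0) {m n : Matrix (Fin 3) (Fin 3) k} (h : m * n = 1) :
    jacobianIdeal 2 (conics (linForm m)) = Ideal.span (Set.range (quadrics (linForm m))) := by
  set x := linForm m with hx
  have hd : ∀ a b l, pderiv l (x a * x a - x b * x b) = 2 * (C (m a l) * x a - C (m b l) * x b) := by
    intro a b l
    simp only [map_sub, Derivation.leibniz, smul_eq_mul, hx, pderiv_linForm]
    ring
  have hq : ∀ i, quadrics x i ∈ Ideal.span (Set.range (quadrics x)) := fun i =>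
    Ideal.subset_span ⟨i, rfl⟩
  have q0 : x 0 * x 1 ∈ Ideal.span (Set.range (quadrics x)) := hq 0
  have q1 : x 0 * x 2 ∈ Ideal.span (Set.range (quadrics x)) := hq 1
  have q2 : x 1 * x 2 ∈ Ideal.span (Set.range (quadrics x)) := hq 2
  apply le_antisymm
  · refine sup_le (Ideal.span_le.mpr ?_) (Ideal.span_le.mpr ?_)
    · rintro _ ⟨i, rfl⟩
      fin_cases i
      exacts [hq 3, hq 4]
    · have key : ∀ a b : Fin 3, (pderiv a (conics x 0) * pderiv b (conics x 1)) -
          (pderiv b (conics x 0) * pderiv a (conics x 1)) ∈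
            Ideal.span (Set.range (quadrics x)) := by
        intro a b
        have e : (pderiv a (conics x 0) * pderiv b (conics x 1)) -
          (pderiv b (conics x 0) * pderiv a (conics x 1)) =
          4 * (C (m 0 a) * C (m 1 b) - C (m 0 b) * C (m 1 a)) * (x 0 * x 1) +
          4 * (C (m 0 b) * C (m 2 a) - C (m 0 a) * C (m 2 b)) * (x 0 * x 2) +
          4 * (C (m 2 b) * C (m 1 a) - C (m 2 a) * C (m 1 b)) * (x 1 * x 2) := by
          simp only [conics, Matrix.cons_val_zero, Matrix.cons_val_one, hd]
          ring
        rw [e]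
        exact add_mem (add_mem (Ideal.mul_mem_left _ _ q0) (Ideal.mul_mem_left _ _ q1))
          (Ideal.mul_mem_left _ _ q2)
      rintro _ ⟨r, c, rfl⟩
      rw [SetLike.mem_coe, Matrix.det_fin_two]
      simp only [jacobianMatrix, Matrix.submatrix_apply, Matrix.of_apply]
      have hr : ∀ i : Fin 2, i = 0 ∨ i = 1 := by decide
      rcases hr (r 0) with h0 | h0 <;> rcases hr (r 1) with h1 | h1 <;> rw [h0, h1]
      · convert zero_mem (Ideal.span (Set.range (quadrics x))) using 1
        ring
      · exact key _ _
      · convert key (c 1) (c 0) using 1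
        ring
      · convert zero_mem (Ideal.span (Set.range (quadrics x))) using 1
        ring
  · set K := jacobianIdeal 2 (conics x) with hK
    have hc : ∀ i, conics x i ∈ K := fun i => Ideal.mem_sup_left (Ideal.subset_span ⟨i, rfl⟩)
    have hm : ∀ a b : Fin 3, pderiv a (conics x 0) * pderiv b (conics x 1) -
        pderiv b (conics x 0) * pderiv a (conics x 1) ∈ K := by
      intro a b
      have : _ ∈ K := Ideal.mem_sup_right (Ideal.subset_span ⟨![0, 1], ![a, b], rfl⟩)
      rw [Matrix.det_fin_two] at this
      simpa [jacobianMatrix] using this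
    -- the minor of the derivatives in the directions of two columns of `n`
    have hdir : ∀ i j : Fin 3, (∑ a, C (n a i) * pderiv a (conics x 0)) *
        (∑ b, C (n b j) * pderiv b (conics x 1)) - (∑ b, C (n b j) * pderiv b (conics x 0)) *
        (∑ a, C (n a i) * pderiv a (conics x 1)) ∈ K := by
      intro i j
      have : (∑ a, C (n a i) * pderiv a (conics x 0)) *
        (∑ b, C (n b j) * pderiv b (conics x 1)) - (∑ b, C (n b j) * pderiv b (conics x 0)) *
        (∑ a, C (n a i) * pderiv a (conics x 1)) = ∑ a, ∑ b, C (n a i) * C (n b j) *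
          (pderiv a (conics x 0) * pderiv b (conics x 1) -
            pderiv b (conics x 0) * pderiv a (conics x 1)) := by
        rw [mul_comm (∑ b, C (n b j) * pderiv b (conics x 0)), Finset.sum_mul_sum,
          Finset.sum_mul_sum, ← Finset.sum_sub_distrib]
        refine Finset.sum_congr rfl fun a _ => ?_
        rw [← Finset.sum_sub_distrib]
        exact Finset.sum_congr rfl fun b _ => by ring
      rw [this]
      exact Ideal.sum_mem _ fun a _ => Ideal.sum_mem _ fun b _ => Ideal.mul_mem_left _ _ (hm a b)
    have hdel : ∀ i j, ∑ a, C (n a i) * C (m j a) = (C ((1 : Matrix _ _ k) j i) : MvPolynomial (Fin 3) k) := by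
      intro i j
      rw [← h, Matrix.mul_apply, map_sum]
      exact Finset.sum_congr rfl fun a _ => by rw [C_mul, mul_comm]
    have hdd : ∀ i a b, ∑ l, C (n l i) * pderiv l (x a * x a - x b * x b) =
        2 * (C ((1 : Matrix _ _ k) a i) * x a - C ((1 : Matrix _ _ k) b i) * x b) := by
      intro i a b
      rw [← hdel, ← hdel, Finset.sum_mul, Finset.sum_mul, ← Finset.sum_sub_distrib, Finset.mul_sum]
      refine Finset.sum_congr rfl fun l _ => ?_
      rw [hd]; ring
    -- In the coordinates given by m, the minors are 4xy and, up to sign, 4xz and 4yz.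
    have hunit : ∀ p, 4 * p ∈ K → p ∈ K := by
      intro p hp
      have : p = C (4⁻¹ : k) * (4 * p) := by
        have h4 : (4 : k) ≠ 0 := by
          rw [show (4 : k) = 2 * 2 by norm_num]; exact mul_ne_zero h2 h2
        have : (4 : MvPolynomial (Fin 3) k) = C 4 := by rw [map_ofNat]
        rw [this, ← mul_assoc, ← C_mul, inv_mul_cancel₀ h4, C_1, one_mul]
      rw [this]
      exact Ideal.mul_mem_left _ _ hp
    have r0 : x 0 * x 1 ∈ K := by
      apply hunit
      have := hdir 0 1
      simp only [conics, Matrix.cons_val_zero, Matrix.cons_val_one, hdd] at this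
      convert this using 1
      simp
      ring
    have r1 : x 0 * x 2 ∈ K := by
      apply hunit
      rw [← neg_mem_iff]
      have := hdir 0 2
      simp only [conics, Matrix.cons_val_zero, Matrix.cons_val_one, hdd] at this
      convert this using 1
      simp
      ring
    have r2 : x 1 * x 2 ∈ K := by
      apply hunit
      rw [← neg_mem_iff]
      have := hdir 2 1
      simp only [conics, Matrix.cons_val_zero, Matrix.cons_val_one, hdd] at this
      convert this using 1
      simp
      ring
    refine Ideal.span_le.mpr ?_
    rintro _ ⟨i, rfl⟩
    fin_cases i
    exacts [r0, r1, r2, hc 0, hc 1]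

end Jacobian

/-! ### Four points in general position and their ideal -/

section Points

variable {k : Type*} [Field k]

/-- The four points `(±1, ±1, 1)`. -/
def signVec (k : Type*) [Field k] : Fin 4 → Fin 3 → k :=
  ![![1, 1, 1], ![-1, 1, 1], ![1, -1, 1], ![-1, -1, 1]]

lemma linearIndependent_rep {p : Fin 4 → ℙ k (Fin 3 → k)} (hp : InGeneralLinearPosition p)
    {a b c : Fin 4} (h : Function.Injective ![a, b, c]) (x y z : k)
    (hs : x • (p a).rep + y • (p b).rep + z • (p c).rep = 0) : x = 0 ∧ y = 0 ∧ z = 0 := by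
  have := hp ⟨![a, b, c], h⟩
  rw [Projectivization.independent_iff, Fintype.linearIndependent_iff] at this
  have h' := this ![x, y, z] (by simpa [Fin.sum_univ_three] using hs)
  exact ⟨h' 0, h' 1, h' 2⟩

/-- Four points in general linear position are `(±1, ±1, 1)` in suitable coordinates. -/
lemma exists_coordinates (h2 : (2 : k) ≠ 0) {p : Fin 4 → ℙ k (Fin 3 → k)}
    (hp : InGeneralLinearPosition p) :
    ∃ m n : Matrix (Fin 3) (Fin 3) k, m * n = 1 ∧
      ∀ i, ∃ c : k, c ≠ 0 ∧ m.mulVec (c • (p i).rep) = signVec k i := by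
  let V : Matrix (Fin 3) (Fin 3) k := (Matrix.of ![(p 1).rep, (p 2).rep, (p 3).rep]).transpose
  have hVmul : ∀ u : Fin 3 → k,
      V.mulVec u = u 0 • (p 1).rep + u 1 • (p 2).rep + u 2 • (p 3).rep := by
    intro u
    funext l
    simp [V, Matrix.mulVec, dotProduct, Fin.sum_univ_three, mul_comm]
  have hV : IsUnit V.det := by
    rw [isUnit_iff_ne_zero]
    intro h0
    obtain ⟨u, hu0, hu⟩ := Matrix.exists_mulVec_eq_zero_iff.mpr h0
    rw [hVmul] at hu
    obtain ⟨e0, e1, e2⟩ := linearIndependent_rep hp (by decide) _ _ _ hu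
    apply hu0
    funext i
    fin_cases i <;> assumption
  let α := V⁻¹.mulVec (p 0).rep
  have hα : α 0 • (p 1).rep + α 1 • (p 2).rep + α 2 • (p 3).rep = (p 0).rep := by
    rw [← hVmul, Matrix.mulVec_mulVec, Matrix.mul_nonsing_inv _ hV, Matrix.one_mulVec]
  have hα0 : α 0 ≠ 0 := by
    intro h0
    rw [h0, zero_smul, zero_add] at hα
    have := linearIndependent_rep hp (a := 2) (b := 3) (c := 0) (by decide) (α 1) (α 2) (-1)
      (by rw [hα]; simp)
    simp at this
  have hα1 : α 1 ≠ 0 := by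
    intro h0
    rw [h0, zero_smul, add_zero] at hα
    have := linearIndependent_rep hp (a := 1) (b := 3) (c := 0) (by decide) (α 0) (α 2) (-1)
      (by rw [hα]; simp)
    simp at this
  have hα2 : α 2 ≠ 0 := by
    intro h0
    rw [h0, zero_smul, add_zero] at hα
    have := linearIndependent_rep hp (a := 1) (b := 2) (c := 0) (by decide) (α 0) (α 1) (-1)
      (by rw [hα]; simp)
    simp at this
  -- E sends the three unit vectors and (1, 1, 1) to (-1, 1, 1), (1, -1, 1), (1, 1, -1) and (1, 1,
  -- 1). Its inverse E' requires 2 ≠ 0.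
  let E : Matrix (Fin 3) (Fin 3) k := !![-1, 1, 1; 1, -1, 1; 1, 1, -1]
  let E' : Matrix (Fin 3) (Fin 3) k := !![0, 2⁻¹, 2⁻¹; 2⁻¹, 0, 2⁻¹; 2⁻¹, 2⁻¹, 0]
  have hE : E * E' = 1 := by
    ext i j
    fin_cases i <;> fin_cases j <;>
      simp [E, E', Matrix.mul_apply, Fin.sum_univ_three] <;> field_simp <;> norm_num
  let Δ : Matrix (Fin 3) (Fin 3) k := Matrix.diagonal fun i => (α i)⁻¹
  let Δ' : Matrix (Fin 3) (Fin 3) k := Matrix.diagonal α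
  have hαi : ∀ i, α i ≠ 0 := by
    intro i
    fin_cases i <;> assumption
  have hΔ : Δ * Δ' = 1 := by
    simp only [Δ, Δ', Matrix.diagonal_mul_diagonal]
    rw [← Matrix.diagonal_one]
    congr 1
    funext i
    exact inv_mul_cancel₀ (hαi i)
  have hm : ∀ u : Fin 3 → k, (E * Δ * V⁻¹).mulVec (V.mulVec u) =
      E.mulVec fun i => (α i)⁻¹ * u i := by
    intro u
    rw [Matrix.mulVec_mulVec, Matrix.mul_assoc, Matrix.nonsing_inv_mul _ hV, Matrix.mul_one,
      ← Matrix.mulVec_mulVec]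
    congr 1
    funext i
    simp [Δ, Matrix.mulVec_diagonal]
  refine ⟨E * Δ * V⁻¹, V * (Δ' * E'), ?_, ?_⟩
  · rw [Matrix.mul_assoc, ← Matrix.mul_assoc V⁻¹, Matrix.nonsing_inv_mul _ hV, Matrix.one_mul,
      Matrix.mul_assoc, ← Matrix.mul_assoc Δ, hΔ, Matrix.one_mul, hE]
  · have key : ∀ (i : Fin 4) (c : k) (u : Fin 3 → k), c • (p i).rep = V.mulVec u →
        (E.mulVec fun i => (α i)⁻¹ * u i) = signVec k i →
        (E * Δ * V⁻¹).mulVec (c • (p i).rep) = signVec k i := fun i c u h h' => by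
      rw [h, hm, h']
    intro i
    fin_cases i
    · refine ⟨1, one_ne_zero, key 0 1 α (by rw [hVmul, hα, one_smul]) ?_⟩
      simp only [inv_mul_cancel₀ (hαi _)]
      funext j
      fin_cases j <;> simp [E, signVec, Matrix.mulVec, dotProduct, Fin.sum_univ_three]
    · refine ⟨α 0, hα0, key 1 _ ![α 0, 0, 0] (by rw [hVmul]; simp) ?_⟩
      funext j
      fin_cases j <;>
        simp [E, signVec, Matrix.mulVec, dotProduct, Fin.sum_univ_three, hα0]
    · refine ⟨α 1, hα1, key 2 _ ![0, α 1, 0] (by rw [hVmul]; simp) ?_⟩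
      funext j
      fin_cases j <;>
        simp [E, signVec, Matrix.mulVec, dotProduct, Fin.sum_univ_three, hα1]
    -- The sign turns (1, 1, -1) into the chosen representative (-1, -1, 1).
    · refine ⟨-α 2, neg_ne_zero.mpr hα2, key 3 _ ![0, 0, -α 2] (by rw [hVmul]; simp) ?_⟩
      funext j
      fin_cases j <;>
        simp [E, signVec, Matrix.mulVec, dotProduct, Fin.sum_univ_three, hα2]

lemma aeval_mul_of_isHomogeneous {σ A : Type*} [CommRing A] [Algebra k A] {d : ℕ}
    {g : MvPolynomial σ k} (hg : g.IsHomogeneous d) (s : A) (a : σ → k) :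
    aeval (fun l => s * algebraMap k A (a l)) g = s ^ d * algebraMap k A (eval a g) := by
  rw [aeval_def, eval₂_eq, eval_eq, map_sum, Finset.mul_sum]
  refine Finset.sum_congr rfl fun e he => ?_
  simp only [mul_pow, Finset.prod_mul_distrib, map_mul, map_prod, map_pow]
  rw [Finset.prod_pow_eq_pow_sum, ← hg.degree_eq_sum_deg_support he]
  ring

/-- Elements of the ideal of a point vanish along the line through that point. -/
lemma aeval_line_eq_zero_of_mem_pointIdeal {n : ℕ} {p : ℙ k (Fin (n + 1) → k)} (c : k)
    {f : MvPolynomial (Fin (n + 1)) k} (hf : f ∈ pointIdeal p) :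
    aeval (fun l => Polynomial.C ((c • p.rep) l) * Polynomial.X) f = 0 := by
  suffices pointIdeal p ≤ RingHom.ker (aeval (fun l => Polynomial.C ((c • p.rep) l) *
      Polynomial.X) : MvPolynomial (Fin (n + 1)) k →ₐ[k] Polynomial k).toRingHom from this hf
  refine Ideal.span_le.mpr ?_
  rintro g ⟨d, hg, hg0⟩
  change aeval (fun l => Polynomial.C ((c • p.rep) l) * Polynomial.X) g = 0
  have hl : (fun l => Polynomial.C ((c • p.rep) l) * Polynomial.X) = fun l =>
      (Polynomial.C c * Polynomial.X) * algebraMap k (Polynomial k) (p.rep l) := by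
    funext l
    simp only [Pi.smul_apply, smul_eq_mul, map_mul, Polynomial.algebraMap_apply,
      Algebra.algebraMap_self, RingHom.id_apply]
    ring
  rw [hl, aeval_mul_of_isHomogeneous hg, hg0, map_zero, mul_zero]

/-- Normal forms modulo the two conics. -/
lemma exists_normalForm {m n : Matrix (Fin 3) (Fin 3) k} (h : m * n = 1)
    (f : MvPolynomial (Fin 3) k) :
    ∃ a b c d : Polynomial k, f - (Polynomial.aeval (linForm m 2) a +
      Polynomial.aeval (linForm m 2) b * linForm m 0 +
      Polynomial.aeval (linForm m 2) c * linForm m 1 +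
      Polynomial.aeval (linForm m 2) d * (linForm m 0 * linForm m 1)) ∈
        Ideal.span (Set.range (conics (linForm m))) := by
  obtain ⟨f, rfl⟩ := aeval_linForm_surjective h f
  have hc0 : linForm m 0 * linForm m 0 - linForm m 2 * linForm m 2 ∈
      Ideal.span (Set.range (conics (linForm m))) := Ideal.subset_span ⟨0, rfl⟩
  have hc1 : linForm m 1 * linForm m 1 - linForm m 2 * linForm m 2 ∈
      Ideal.span (Set.range (conics (linForm m))) := Ideal.subset_span ⟨1, rfl⟩
  set J := Ideal.span (Set.range (conics (linForm m)))
  induction f using MvPolynomial.induction_on with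
  | C a =>
    refine ⟨Polynomial.C a, 0, 0, 0, ?_⟩
    simp [algHom_C]
  | add f g hf hg =>
    obtain ⟨a, b, c, d, hf⟩ := hf
    obtain ⟨a', b', c', d', hg⟩ := hg
    refine ⟨a + a', b + b', c + c', d + d', ?_⟩
    convert add_mem hf hg using 1
    simp only [map_add]
    ring
  | mul_X f i hf =>
    obtain ⟨a, b, c, d, hf⟩ := hf
    rw [map_mul, aeval_X]
    fin_cases i
    -- Multiplication by x with x² replaced by z² sends a + bx + cy + dxy to bz² + ax + dz² y + cxy;
    -- multiplication by y is analogous.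
    · refine ⟨b * Polynomial.X ^ 2, a, d * Polynomial.X ^ 2, c, ?_⟩
      convert add_mem (Ideal.mul_mem_left _ (linForm m 0) hf)
        (Ideal.mul_mem_left _ (Polynomial.aeval (linForm m 2) b +
          Polynomial.aeval (linForm m 2) d * linForm m 1) hc0) using 1
      simp only [map_mul, map_pow, Polynomial.aeval_X, Fin.zero_eta]
      ring
    · refine ⟨c * Polynomial.X ^ 2, d * Polynomial.X ^ 2, a, b, ?_⟩
      convert add_mem (Ideal.mul_mem_left _ (linForm m 1) hf)
        (Ideal.mul_mem_left _ (Polynomial.aeval (linForm m 2) c +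
          Polynomial.aeval (linForm m 2) d * linForm m 0) hc1) using 1
      simp only [map_mul, map_pow, Polynomial.aeval_X, Fin.mk_one]
      ring
    · refine ⟨a * Polynomial.X, b * Polynomial.X, c * Polynomial.X, d * Polynomial.X, ?_⟩
      convert Ideal.mul_mem_left _ (linForm m 2) hf using 1
      simp only [map_mul, Polynomial.aeval_X, Fin.reduceFinMk]
      ring

/-- The ideal of the four points is generated by two conics. -/
lemma pointsIdeal_eq_span_conics (h2 : (2 : k) ≠ 0) {p : Fin 4 → ℙ k (Fin 3 → k)}
    {m n : Matrix (Fin 3) (Fin 3) k} (h : m * n = 1)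
    (hm : ∀ i, ∃ c : k, c ≠ 0 ∧ m.mulVec (c • (p i).rep) = signVec k i) :
    pointsIdeal p = Ideal.span (Set.range (conics (linForm m))) := by
  choose γ hγ0 hγ using hm
  have hsq : ∀ i r, signVec k i r * signVec k i r = 1 := by
    intro i r
    fin_cases i <;> fin_cases r <;> simp [signVec]
  have hJ : Ideal.span (Set.range (conics (linForm m))) ≤ pointsIdeal p := by
    have heval : ∀ i r, γ i * eval (p i).rep (linForm m r) = signVec k i r := by
      intro i r
      rw [← hγ i, Matrix.mulVec_smul]
      simp [linForm, Matrix.mulVec, dotProduct]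
    have hmem : ∀ i r, linForm m r * linForm m r - linForm m 2 * linForm m 2 ∈
        pointIdeal (p i) := by
      intro i r
      refine Ideal.subset_span ⟨2, ?_, ?_⟩
      · exact ((isHomogeneous_linForm m r).mul (isHomogeneous_linForm m r)).sub
          ((isHomogeneous_linForm m 2).mul (isHomogeneous_linForm m 2))
      · apply mul_left_cancel₀ (mul_ne_zero (hγ0 i) (hγ0 i))
        have e1 := hsq i r
        have e2 := hsq i 2
        rw [← heval i r] at e1
        rw [← heval i 2] at e2
        simp only [map_sub, map_mul]
        linear_combination e1 - e2
    refine le_iInf fun i => Ideal.span_le.mpr ?_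
    rintro _ ⟨j, rfl⟩
    fin_cases j
    exacts [hmem i 0, hmem i 1]
  refine le_antisymm (fun f hf => ?_) hJ
  obtain ⟨a, b, c, d, hn⟩ := exists_normalForm h f
  -- Restriction of the normal form to the four lines gives a ± bX ± cX ± dX² = 0 with the signs of
  -- the points. Signed sums isolate each term with factor 4, which is nonzero.
  have hz : ∀ i, a + b * (Polynomial.C (signVec k i 0) * Polynomial.X) +
      c * (Polynomial.C (signVec k i 1) * Polynomial.X) +
      d * (Polynomial.C (signVec k i 0) * Polynomial.X *
        (Polynomial.C (signVec k i 1) * Polynomial.X)) = 0 := by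
    intro i
    set ev : MvPolynomial (Fin 3) k →ₐ[k] Polynomial k :=
      aeval (fun l => Polynomial.C ((γ i • (p i).rep) l) * Polynomial.X) with hev
    have hl : ∀ r, ev (linForm m r) = Polynomial.C (signVec k i r) * Polynomial.X := by
      intro r
      rw [hev, aeval_linForm, ← hγ i]
      simp only [Matrix.mulVec, dotProduct, map_sum, Finset.sum_mul, map_mul,
        Polynomial.algebraMap_apply, Algebra.algebraMap_self, RingHom.id_apply, mul_assoc]
    have hl2 : ev (linForm m 2) = Polynomial.X := by
      rw [hl]
      have : signVec k i 2 = 1 := by fin_cases i <;> rfl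
      rw [this, map_one, one_mul]
    have hval : ∀ g : Polynomial k, ev (Polynomial.aeval (linForm m 2) g) = g := by
      intro g
      rw [← Polynomial.aeval_algHom_apply, hl2, Polynomial.aeval_X_left_apply]
    have h1 : ev f = 0 := aeval_line_eq_zero_of_mem_pointIdeal _ (Ideal.mem_iInf.mp hf i)
    have h3 : ev _ = 0 := aeval_line_eq_zero_of_mem_pointIdeal (γ i) (Ideal.mem_iInf.mp (hJ hn) i)
    rw [map_sub, h1, zero_sub, neg_eq_zero] at h3
    simpa only [map_add, map_mul, hval, hl] using h3
  have z0 := hz 0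
  have z1 := hz 1
  have z2 := hz 2
  have z3 := hz 3
  simp [signVec] at z0 z1 z2 z3
  have h4 : (4 : Polynomial k) ≠ 0 := by
    have : (4 : Polynomial k) = Polynomial.C (2 * 2) := by
      rw [map_mul, map_ofNat]; norm_num
    rw [this, Polynomial.C_ne_zero]
    exact mul_ne_zero h2 h2
  have hX := Polynomial.X_ne_zero (R := k)
  have ha : a = 0 := by
    apply mul_left_cancel₀ h4
    linear_combination z0 + z1 + z2 + z3
  have hb : b = 0 := by
    apply mul_left_cancel₀ (mul_ne_zero h4 hX)
    linear_combination z0 - z1 + z2 - z3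
  have hc : c = 0 := by
    apply mul_left_cancel₀ (mul_ne_zero h4 hX)
    linear_combination z0 + z1 - z2 - z3
  have hd : d = 0 := by
    apply mul_left_cancel₀ (mul_ne_zero h4 (mul_ne_zero hX hX))
    linear_combination z0 - z1 - z2 + z3
  simpa [ha, hb, hc, hd] using hn

end Points

/-! ### Multiplication by the missing square -/

section Quadrics

variable {k : Type*} [Field k] {m n : Matrix (Fin 3) (Fin 3) k}

/-- The square of the third linear form is not in the ideal of the five quadrics. -/
lemma sq_notMem_span_quadrics (h : m * n = 1) :
    linForm m 2 * linForm m 2 ∉ Ideal.span (Set.range (quadrics (linForm m))) := by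
  intro hmem
  obtain ⟨c, hc⟩ := exists_coeff_of_mem_span (isHomogeneous_quadrics m)
    ((isHomogeneous_linForm m 2).mul (isHomogeneous_linForm m 2)) hmem
  have := (quadrics_independent h c (-1) (by rw [← hc]; simp)).2
  simp at this

/-- For the three forms: x z² = z · xz, y z² = z · yz and z · z² = x · xz - z · (x² - z²). -/
lemma X_mul_sq_mem_span_quadrics (h : m * n = 1) (l : Fin 3) :
    X l * (linForm m 2 * linForm m 2) ∈ Ideal.span (Set.range (quadrics (linForm m))) := by
  have hq : ∀ i, quadrics (linForm m) i ∈ Ideal.span (Set.range (quadrics (linForm m))) :=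
    fun i => Ideal.subset_span ⟨i, rfl⟩
  set I := Ideal.span (Set.range (quadrics (linForm m)))
  have hr : ∀ r, linForm m r * (linForm m 2 * linForm m 2) ∈ I := by
    intro r
    fin_cases r
    · convert Ideal.mul_mem_left I (linForm m 2) (hq 1) using 1
      simp [quadrics]; ring
    · convert Ideal.mul_mem_left I (linForm m 2) (hq 2) using 1
      simp [quadrics]; ring
    · convert sub_mem (Ideal.mul_mem_left I (linForm m 0) (hq 1))
        (Ideal.mul_mem_left I (linForm m 2) (hq 3)) using 1
      simp [quadrics]; ring
  rw [← sum_mul_linForm (mul_eq_one_comm.mp h) l, Finset.sum_mul]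
  refine Ideal.sum_mem _ fun r _ => ?_
  rw [mul_assoc]
  exact Ideal.mul_mem_left _ _ (hr r)

/-- On generators these are the identities recorded in the last five entries of `mulW`, such as xy ·
z² = xz · yz. -/
lemma mul_sq_mem_span_quadrics_sq {A : Type*} [CommRing A] (x : Fin 3 → A) {f : A}
    (hf : f ∈ Ideal.span (Set.range (quadrics x))) :
    f * (x 2 * x 2) ∈ Ideal.span (Set.range (quadrics x)) ^ 2 := by
  have hq : ∀ i j, quadrics x i * quadrics x j ∈ Ideal.span (Set.range (quadrics x)) ^ 2 := by
    intro i j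
    rw [sq]
    exact Ideal.mul_mem_mul (Ideal.subset_span ⟨i, rfl⟩) (Ideal.subset_span ⟨j, rfl⟩)
  induction hf using Submodule.span_induction with
  | mem y hy =>
    obtain ⟨i, rfl⟩ := hy
    fin_cases i
    · convert hq 1 2 using 1
      simp [quadrics]; ring
    · convert sub_mem (hq 0 2) (hq 1 4) using 1
      simp [quadrics]; ring
    · convert sub_mem (hq 0 1) (hq 2 3) using 1
      simp [quadrics]; ring
    · convert sub_mem (sub_mem (hq 0 0) (hq 2 2)) (hq 3 4) using 1
      simp [quadrics]; ring
    · convert sub_mem (sub_mem (hq 0 0) (hq 1 1)) (hq 3 4) using 1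
      simp [quadrics]; ring
  | zero => simp
  | add y z _ _ hy hz => rw [add_mul]; exact add_mem hy hz
  | smul c y _ hy => rw [smul_eq_mul, mul_assoc]; exact Ideal.mul_mem_left _ _ hy

end Quadrics

end JacobianRees

end

theorem proposition3p1 {k : Type*} [Field k] [IsAlgClosed k] (h2 : (2 : k) ≠ 0)
    (p : Fin 4 → ℙ k (Fin 3 → k)) (hp : InGeneralLinearPosition p)
    {m : ℕ} (g : Fin m → MvPolynomial (Fin 3) k)
    (hg : Ideal.span (Set.range g) = pointsIdeal p)
    (I : Ideal (MvPolynomial (Fin 3) k)) (hI : I = jacobianIdeal 2 g) :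
    (∃ φ : Matrix (Fin 5) (Fin 5) (MvPolynomial (Fin 3) k), IsPfaffianMatrix φ I) ∧
    (∀ φ : Matrix (Fin 5) (Fin 5) (MvPolynomial (Fin 3) k), IsPfaffianMatrix φ I →
      (∃ e : (MvPolynomial (Fin 5) (MvPolynomial (Fin 3) k) ⧸ dualIdeal φ)
            ≃ₐ[MvPolynomial (Fin 3) k] reesAlgebra I,
          ∀ i, (e (Ideal.Quotient.mk (dualIdeal φ) (MvPolynomial.X i)) :
              Polynomial (MvPolynomial (Fin 3) k)) =
            Polynomial.monomial 1 (pfaffians φ i)) ∧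
      HasFiberTypeRelations (pfaffians φ)) ∧
    IsFiberType I ∧
    depthAlong (reesMaximalIdeal I) = 1 := by
  obtain ⟨a, b, hab, hpt⟩ := exists_coordinates h2 hp
  have hJ : I = Ideal.span (Set.range (quadrics (linForm a))) := by
    rw [hI, jacobianIdeal_two_congr (hg.trans (pointsIdeal_eq_span_conics h2 hab hpt)),
      jacobianIdeal_conics h2 hab]
  clear hI hg
  subst hJ
  have hφ₀ := isPfaffianMatrix_quadricsMatrix a
  have hfiber : ∀ φ, IsPfaffianMatrix φ (Ideal.span (Set.range (quadrics (linForm a)))) →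
      HasFiberTypeRelations (pfaffians φ) := fun φ hφ =>
    hasFiberTypeRelations_of_dualIdeal_eq hφ.linear (dualIdeal_eq_reesIdeal h2 hab hφ)
  refine ⟨⟨_, hφ₀⟩, fun φ hφ => ⟨?_, hfiber φ hφ⟩, ?_, ?_⟩
  · exact exists_equiv_reesAlgebra _ hφ.span_eq (dualIdeal_eq_reesIdeal h2 hab hφ)
  · exact ⟨5, 2, _, isHomogeneous_pfaffians hφ₀.linear, hφ₀.span_eq, hfiber _ hφ₀⟩
  · exact depthAlong_reesMaximalIdeal_eq_one (sq_notMem_span_quadrics hab)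
      (X_mul_sq_mem_span_quadrics hab) fun f hf => mul_sq_mem_span_quadrics_sq _ hf
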